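/- Let $n,j\ge 1$. Put $\rho_n=\sum_{i=1}^{2n+1}(-1)^{n+i-1}e_{i,2n+2-i}$, let $\mathbb R^{n+1,n}$ be $\mathbb R^{2n+1}$ with $\langle X,Y\rangle=X^t\rho_nY$, let $V^\perp$ be the orthogonal complement of a subspace $V$ with respect to this form, and put $A^\sharp=\rho_nA^t\rho_n$. Let $O_{\mathbb C}(n+1,n)=\{g\in SL(2n+1,\mathbb C): g^t\rho_ng=\rho_n\}$, $o(n+1,n)=\{A\in gl(2n+1,\mathbb R): A^t\rho_n+\rho_nA=0\}$, and let $\mathcal B_n^+$ be the set of upper triangular matrices in $o(n+1,n)$. Put $\beta=\frac12(e_{1,2n}+e_{2,2n+1})$, $b=\sum_{i=1}^{2n}e_{i+1,i}$ and $J_B(\lambda)=\beta\lambda+b$. For a smooth $\mathcal B_n^+$-valued function $q$ of $(x,t)$ on an open subset of $\mathbb R^2$, let $T(q,\lambda)=\beta\lambda+\sum_{i\le 0}T_{1,i}(q)\lambda^i$ be the unique formal series with smooth coefficients in $o(n+1,n)$ such that $[\partial_x+J_B(\lambda)+q,\,T(q,\lambda)]=0$ and $T(q,\lambda)^{2n+1}=\lambda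 T(q,\lambda)$. Let $T_{2j-1,i}(q)$ be the coefficient of $\lambda^i$ in $T(q,\lambda)^{2j-1}$ and $(T^{2j-1}(q,\lambda))_+=\sum_{i\ge 0}T_{2j-1,i}(q)\lambda^i$. The $(2j-1)$-th $\hat B_n^{(1)}$-flow is $$q_t=[\partial_x+b+q,\ T_{2j-1,0}(q)].\qquad(*)$$ A *frame* of a solution $q$ of $(*)$ is a smooth map $F(x,t,\lambda)\in O_{\mathbb C}(n+1,n)$, holomorphic in $\lambda\in\mathbb C$, with $F^{-1}F_x=J_B(\lambda)+q$, $F^{-1}F_t=(T^{2j-1}(q,\lambda))_+$ and $\overline{F(x,t,\bar\lambda)}=F(x,t,\lambda)$. For real $\alpha_1\ne\alpha_2$ and a projection $\pi$ (that is, $\pi^2=\pi$) put $h_{\alpha_1,\alpha_2,\pi}(\lambda)=\mathrm I+\frac{\alpha_1-\alpha_2}{\lambda-\alpha_1}(\mathrm I-\pi)$ and $g_{\alpha_1,\alpha_2,\pi}=h_{\alpha_2,\alpha_1,\pi^\sharp}\,h_{\alpha_1,\alpha_2,\pi}$. **Theorem.** Let $F$ be a frame of a smooth solution $q:\mathbb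 R^2\to\mathcal B_n^+$ of $(*)$, let $\alpha_1\ne\alpha_2$ be real, and let $\pi$ be a projection of $\mathbb R^{n+1,n}$, of any rank, onto $V_1$ along $V_2$ with $\pi\pi^\sharp=\pi^\sharp\pi=0$. Put $\tilde V_i(x,t)=F(x,t,\alpha_i)^{-1}(V_i)$, $i=1,2$, and assume that $\tilde V_1(x,t)\cap\tilde V_2(x,t)=\{0\}$ for all $(x,t)$ in an open set $\mathcal O\subset\mathbb R^2$. Then on $\mathcal O$ we have $\mathbb R^{n+1,n}=\tilde V_1\oplus\tilde V_2$. Let $\tilde\pi(x,t)$ be the projection onto $\tilde V_1(x,t)$ along $\tilde V_2(x,t)$. The map $$k(x,t,\lambda)=h_{\alpha_1,\alpha_2,\pi}(\lambda)F(x,t,\lambda)h_{\alpha_1,\alpha_2,\tilde\pi(x,t)}^{-1}(\lambda)$$ has removable singularities at $\lambda=\alpha_1,\alpha_2$, and its extension, again denoted $k$, is entire in $\lambda$ with invertible values. Put $W_i(x,t)=k(x,t,\alpha_i)^{-1}(V_i^\perp)$, $i=1,2$, and assume that $W_1(x,t)\cap W_2(x,t)=\{0\}$ for all $(x,t)$ in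 an open set $\mathcal O_1\subset\mathcal O$. Then on $\mathcal O_1$ we have $\mathbb R^{n+1,n}=W_1\oplus W_2$. Let $\theta(x,t)$ be the projection onto $W_2(x,t)$ along $W_1(x,t)$. Then $$\tilde q=q+(\alpha_1-\alpha_2)[\beta,\tilde\pi-\theta]$$ is a smooth $\mathcal B_n^+$-valued solution of $(*)$ on $\mathcal O_1$, and $$\tilde F(x,t,\lambda)=g_{\alpha_1,\alpha_2,\pi}(\lambda)F(x,t,\lambda)h_{\alpha_1,\alpha_2,\tilde\pi(x,t)}^{-1}(\lambda)h_{\alpha_2,\alpha_1,\theta(x,t)}^{-1}(\lambda)$$ (with its removable singularities at $\lambda=\alpha_1,\alpha_2$ removed) is a frame of $\tilde q$ on $\mathcal O_1$. -/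

import Mathlib

open scoped Matrix ContDiff Topology

noncomputable section

namespace BnDarboux

/-- Real matrices of size `2n+1`. The indices `0, …, 2n` stand for `1, …, 2n+1`. -/
abbrev RMat (n : ℕ) := Matrix (Fin (2 * n + 1)) (Fin (2 * n + 1)) ℝ

/-- Complex matrices of size `2n+1`. -/
abbrev CMat (n : ℕ) := Matrix (Fin (2 * n + 1)) (Fin (2 * n + 1)) ℂ

/-- The vector space underlying `ℝ^{n+1,n}`. -/
abbrev RVec (n : ℕ) := Fin (2 * n + 1) → ℝ

/-- Matrices of size `2n+1` over the field of formal Laurent series in `λ⁻¹` with real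
coefficients, i.e. formal series `∑_{i ≤ m} ξ_i λ^i` with matrix coefficients. The variable of
the Laurent series is `λ⁻¹`, so the coefficient of `λ^i` is the one of index `-i`. -/
abbrev LoopMat (n : ℕ) := Matrix (Fin (2 * n + 1)) (Fin (2 * n + 1)) (LaurentSeries ℝ)

/-- A real matrix regarded as a complex one. -/
def cx {n : ℕ} (A : RMat n) : CMat n := A.map (fun r : ℝ => (r : ℂ))

/-- `ρ_n = ∑_{i=1}^{2n+1} (-1)^{n+i-1} e_{i,2n+2-i}`. -/
def rho (n : ℕ) : RMat n :=
  Matrix.of fun a b => if (a : ℕ) + (b : ℕ) = 2 * n then (-1) ^ (n + (a : ℕ)) else 0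

/-- `β = (e_{1,2n} + e_{2,2n+1}) / 2`. -/
def beta (n : ℕ) : RMat n :=
  Matrix.of fun a b =>
    if ((a : ℕ) = 0 ∧ (b : ℕ) + 1 = 2 * n) ∨ ((a : ℕ) = 1 ∧ (b : ℕ) = 2 * n) then 1 / 2 else 0

/-- `b = ∑_{i=1}^{2n} e_{i+1,i}`. -/
def bLow (n : ℕ) : RMat n :=
  Matrix.of fun a b => if (a : ℕ) = (b : ℕ) + 1 then 1 else 0

/-- Membership in `𝓑_n^+`, the upper triangular matrices of `o(n+1,n)`.
The trace of a matrix with `Aᵀ ρ + ρ A = 0` vanishes automatically. -/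
def MemBPlus {n : ℕ} (A : RMat n) : Prop :=
  Aᵀ * rho n + rho n * A = 0 ∧ ∀ a b : Fin (2 * n + 1), b < a → A a b = 0

/-- Membership in `O_ℂ(n+1,n)`. -/
def MemOC {n : ℕ} (g : CMat n) : Prop :=
  g.det = 1 ∧ gᵀ * cx (rho n) * g = cx (rho n)

/-- Entrywise partial derivative in `x` of a matrix function of `(x,t)`. -/
def pdx {n : ℕ} {E : Type} [NormedAddCommGroup E] [NormedSpace ℝ E]
    (f : ℝ × ℝ → Matrix (Fin (2 * n + 1)) (Fin (2 * n + 1)) E) (p : ℝ × ℝ) :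
    Matrix (Fin (2 * n + 1)) (Fin (2 * n + 1)) E :=
  Matrix.of fun a b => deriv (fun s : ℝ => f (s, p.2) a b) p.1

/-- Entrywise partial derivative in `t` of a matrix function of `(x,t)`. -/
def pdt {n : ℕ} {E : Type} [NormedAddCommGroup E] [NormedSpace ℝ E]
    (f : ℝ × ℝ → Matrix (Fin (2 * n + 1)) (Fin (2 * n + 1)) E) (p : ℝ × ℝ) :
    Matrix (Fin (2 * n + 1)) (Fin (2 * n + 1)) E :=
  Matrix.of fun a b => deriv (fun s : ℝ => f (p.1, s) a b) p.2

/-- A real matrix regarded as a constant loop. -/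
def constLoop {n : ℕ} (A : RMat n) : LoopMat n := A.map (HahnSeries.C : ℝ →+* LaurentSeries ℝ)

/-- The loop parameter `λ` as a Laurent series in `λ⁻¹`. -/
def lam : LaurentSeries ℝ := HahnSeries.single (-1 : ℤ) (1 : ℝ)

/-- The coefficient of `λ^i`. -/
def lcoeff {n : ℕ} (i : ℤ) (T : LoopMat n) : RMat n := T.map (fun s => s.coeff (-i))

/-- On the open set `Ω`, `T` is the series `T(q,λ) = βλ + ∑_{i ≤ 0} T_{1,i}(q) λ^i`: it takes
values in the loop algebra of `o(n+1,n)`, and it satisfies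
`[∂_x + βλ + b + q, T] = 0` (written coefficient by coefficient) and `T^{2n+1} = λ T`.
These conditions determine `T` uniquely. -/
structure IsT (n : ℕ) (Ω : Set (ℝ × ℝ)) (q : ℝ × ℝ → RMat n) (T : ℝ × ℝ → LoopMat n) :
    Prop where
  smooth : ∀ (i : ℤ) (a b : Fin (2 * n + 1)),
    ContDiffOn ℝ ∞ (fun p => lcoeff i (T p) a b) Ω
  skew : ∀ p ∈ Ω, (T p)ᵀ * constLoop (rho n) + constLoop (rho n) * T p = 0
  top : ∀ p ∈ Ω, ∀ i : ℤ, 1 < i → lcoeff i (T p) = 0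
  lead : ∀ p ∈ Ω, lcoeff 1 (T p) = beta n
  comm : ∀ p ∈ Ω, ∀ i : ℤ,
    pdx (fun p' => lcoeff i (T p')) p + ⁅bLow n + q p, lcoeff i (T p)⁆
      + ⁅beta n, lcoeff (i - 1) (T p)⁆ = 0
  pow : ∀ p ∈ Ω, T p ^ (2 * n + 1) = lam • T p

/-- `q` is a smooth solution on the open set `Ω`, with values in `𝓑_n^+`, of the `(2j-1)`-th
flow `q_t = [∂_x + b + q, T_{2j-1,0}(q)]`, where `T_{2j-1,i}(q)` is the coefficient of `λ^i`
in `T(q,λ)^{2j-1}`. -/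
structure IsSolutionOn (n j : ℕ) (Ω : Set (ℝ × ℝ)) (q : ℝ × ℝ → RMat n) : Prop where
  smooth : ∀ a b : Fin (2 * n + 1), ContDiffOn ℝ ∞ (fun p => q p a b) Ω
  mem : ∀ p ∈ Ω, MemBPlus (q p)
  flow : ∃ T : ℝ × ℝ → LoopMat n, IsT n Ω q T ∧ ∀ p ∈ Ω,
    pdt q p = pdx (fun p' => lcoeff 0 (T p' ^ (2 * j - 1))) p
      + ⁅bLow n + q p, lcoeff 0 (T p ^ (2 * j - 1))⁆

/-- `J_B(z) = β z + b`. -/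
def JB (n : ℕ) (z : ℂ) : CMat n := z • cx (beta n) + cx (bLow n)

/-- The value at `λ = z` of `(T^{2j-1})_+`, the part with nonnegative powers of `λ`. As `T` has
degree at most `1` in `λ`, only the powers `0, …, 2j-1` can occur. -/
def plusPart {n : ℕ} (j : ℕ) (T : LoopMat n) (z : ℂ) : CMat n :=
  ∑ i ∈ Finset.range (2 * j), z ^ i • cx (lcoeff (i : ℤ) (T ^ (2 * j - 1)))

/-- `F(x,t,λ)` is a frame of `q` on the open set `Ω`: a smooth solution of
`F⁻¹ F_x = J_B(λ) + q`, `F⁻¹ F_t = (T(q,λ)^{2j-1})_+` with values in `O_ℂ(n+1,n)`, satisfying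
the reality condition and holomorphic for `λ ∈ ℂ`. -/
structure IsFrameOn (n j : ℕ) (Ω : Set (ℝ × ℝ)) (q : ℝ × ℝ → RMat n)
    (F : ℝ × ℝ → ℂ → CMat n) : Prop where
  smooth : ∀ a b : Fin (2 * n + 1),
    ContDiffOn ℝ ∞ (fun w : (ℝ × ℝ) × ℂ => F w.1 w.2 a b) (Ω ×ˢ Set.univ)
  holo : ∀ p ∈ Ω, ∀ a b : Fin (2 * n + 1), Differentiable ℂ (fun z => F p z a b)
  mem : ∀ p ∈ Ω, ∀ z : ℂ, MemOC (F p z)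
  real : ∀ p ∈ Ω, ∀ z : ℂ, (F p (starRingEnd ℂ z)).map (starRingEnd ℂ) = F p z
  eq_x : ∀ p ∈ Ω, ∀ z : ℂ, (F p z)⁻¹ * pdx (fun p' => F p' z) p = JB n z + cx (q p)
  eq_t : ∃ T : ℝ × ℝ → LoopMat n, IsT n Ω q T ∧ ∀ p ∈ Ω, ∀ z : ℂ,
    (F p z)⁻¹ * pdt (fun p' => F p' z) p = plusPart j (T p) z

/-- The adjoint `A^♯ = ρ Aᵀ ρ` with respect to `⟨X, Y⟩ = Xᵀ ρ Y`. -/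
def sharp {n : ℕ} (A : RMat n) : RMat n := rho n * Aᵀ * rho n

/-- The orthogonal complement with respect to `⟨X, Y⟩ = Xᵀ ρ Y`. -/
def perp {n : ℕ} (V : Submodule ℝ (RVec n)) : Submodule ℝ (RVec n) :=
  LinearMap.BilinForm.orthogonal (Matrix.toBilin' (rho n)) V

/-- The image `Im A`. -/
def im {n : ℕ} (A : RMat n) : Submodule ℝ (RVec n) := LinearMap.range (Matrix.toLin' A)

/-- The kernel `Ker A`. -/
def ker {n : ℕ} (A : RMat n) : Submodule ℝ (RVec n) := LinearMap.ker (Matrix.toLin' A)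

/-- `A⁻¹(V)` for a subspace `V` of `ℝ^{n+1,n}`: the real vectors that `A` maps into `V`. -/
def invImage {n : ℕ} (A : CMat n) (V : Submodule ℝ (RVec n)) : Submodule ℝ (RVec n) where
  carrier := {v | ∃ w ∈ V, A *ᵥ (fun i => (v i : ℂ)) = fun i => (w i : ℂ)}
  add_mem' := by
    rintro v v' ⟨w, hw, h⟩ ⟨w', hw', h'⟩
    refine ⟨w + w', V.add_mem hw hw', ?_⟩
    have e : (fun i => ((v + v') i : ℂ)) = (fun i => (v i : ℂ)) + fun i => (v' i : ℂ) := by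
      ext i; simp
    rw [e, Matrix.mulVec_add, h, h']
    ext i; simp
  zero_mem' := by
    refine ⟨0, V.zero_mem, ?_⟩
    have e : (fun i => ((0 : RVec n) i : ℂ)) = 0 := by ext i; simp
    rw [e, Matrix.mulVec_zero]
  smul_mem' := by
    rintro c v ⟨w, hw, h⟩
    refine ⟨c • w, V.smul_mem c hw, ?_⟩
    have e : (fun i => ((c • v) i : ℂ)) = (c : ℂ) • fun i => (v i : ℂ) := by
      ext i; simp
    rw [e, Matrix.mulVec_smul, h]
    ext i; simp

open Classical in
/-- The matrix of the projection onto `V` along `W`, for complementary subspaces `V`, `W`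
(and `0` otherwise). -/
def projAlong {n : ℕ} (V W : Submodule ℝ (RVec n)) : RMat n :=
  if h : IsCompl V W then LinearMap.toMatrix' (V.projection W h) else 0

/-- `h_{α₁,α₂,π}(z) = I + (α₁ - α₂) / (z - α₁) π^⊥`, with `π^⊥ = I - π`. -/
def hLoop {n : ℕ} (α₁ α₂ : ℝ) (P : RMat n) (z : ℂ) : CMat n :=
  1 + (((α₁ : ℂ) - (α₂ : ℂ)) / (z - (α₁ : ℂ))) • cx (1 - P)

/-- `g_{α₁,α₂,π} = h_{α₂,α₁,π^♯} h_{α₁,α₂,π}`. -/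
def gLoop {n : ℕ} (α₁ α₂ : ℝ) (P : RMat n) (z : ℂ) : CMat n :=
  hLoop α₂ α₁ (sharp P) z * hLoop α₁ α₂ P z

/-- The function obtained by removing the removable singularities: its value at `z` is the limit
of `f` at `z` through points different from `z`. -/
def holoExt {n : ℕ} (f : ℂ → CMat n) (z : ℂ) : CMat n := Filter.limUnder (𝓝[≠] z) f

section Transform

variable {n : ℕ} (F : ℝ × ℝ → ℂ → CMat n) (α₁ α₂ : ℝ) (P : RMat n)

/-- `Ṽ₁(x,t) = F(x,t,α₁)⁻¹(Im π)`. -/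
def tildeV₁ (p : ℝ × ℝ) : Submodule ℝ (RVec n) := invImage (F p (α₁ : ℂ)) (im P)

/-- `Ṽ₂(x,t) = F(x,t,α₂)⁻¹(Ker π)`. -/
def tildeV₂ (p : ℝ × ℝ) : Submodule ℝ (RVec n) := invImage (F p (α₂ : ℂ)) (ker P)

/-- `π̃(x,t)`, the projection onto `Ṽ₁(x,t)` along `Ṽ₂(x,t)`. -/
def tildeP (p : ℝ × ℝ) : RMat n := projAlong (tildeV₁ F α₁ P p) (tildeV₂ F α₂ P p)

/-- The expression `h_{α₁,α₂,π} F h_{α₁,α₂,π̃}⁻¹`, meaningful for `z ≠ α₁, α₂`. -/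
def kRaw (p : ℝ × ℝ) (z : ℂ) : CMat n :=
  hLoop α₁ α₂ P z * F p z * (hLoop α₁ α₂ (tildeP F α₁ α₂ P p) z)⁻¹

/-- `k(x,t,z)`, with the removable singularities at `α₁`, `α₂` removed. -/
def kLoop (p : ℝ × ℝ) (z : ℂ) : CMat n := holoExt (kRaw F α₁ α₂ P p) z

/-- `W₁(x,t) = k(x,t,α₁)⁻¹((Im π)^⊥)`. -/
def W₁ (p : ℝ × ℝ) : Submodule ℝ (RVec n) :=
  invImage (kLoop F α₁ α₂ P p (α₁ : ℂ)) (perp (im P))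

/-- `W₂(x,t) = k(x,t,α₂)⁻¹((Ker π)^⊥)`. -/
def W₂ (p : ℝ × ℝ) : Submodule ℝ (RVec n) :=
  invImage (kLoop F α₁ α₂ P p (α₂ : ℂ)) (perp (ker P))

/-- `θ(x,t)`, the projection onto `W₂(x,t)` along `W₁(x,t)`. -/
def theta (p : ℝ × ℝ) : RMat n := projAlong (W₂ F α₁ α₂ P p) (W₁ F α₁ α₂ P p)

/-- The expression `g_{α₁,α₂,π} F h_{α₁,α₂,π̃}⁻¹ h_{α₂,α₁,θ}⁻¹`, meaningful for
`z ≠ α₁, α₂`. -/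
def tildeFRaw (p : ℝ × ℝ) (z : ℂ) : CMat n :=
  gLoop α₁ α₂ P z * F p z * (hLoop α₁ α₂ (tildeP F α₁ α₂ P p) z)⁻¹
    * (hLoop α₂ α₁ (theta F α₁ α₂ P p) z)⁻¹

/-- `F̃(x,t,z)`, with the removable singularities at `α₁`, `α₂` removed. -/
def tildeF (p : ℝ × ℝ) (z : ℂ) : CMat n := holoExt (tildeFRaw F α₁ α₂ P p) z

/-- `q̃ = q + (α₁ - α₂) [β, π̃ - θ]`. -/
def tildeQ (q : ℝ × ℝ → RMat n) (p : ℝ × ℝ) : RMat n :=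
  q p + (α₁ - α₂) • ⁅beta n, tildeP F α₁ α₂ P p - theta F α₁ α₂ P p⁆

end Transform

end BnDarboux

end

open BnDarboux

/-! Both halves of the construction are one and the same Darboux step. Let `K` be an entire
invertible family with logarithmic derivative `A(λ)`, and let `Q` be the projection onto `K(α₁)⁻¹(Im
P)` along `K(α₂)⁻¹(Ker P)`. The loop `h_{α₁,α₂,P} K h_{α₁,α₂,Q}⁻¹` has at most simple poles at `α₁`,
`α₂`, with residues proportional to `(1-P) K(α₁) Q` and `P K(α₂) (1-Q)`; both vanish by the choice
of `Q`. Differentiating these two equations gives `Q' = Q A(α₂) (1-Q) - (1-Q) A(α₁) Q`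
(`IsPullbackProj.hasMatrixDerivAt`). With this equation the new logarithmic derivative contains only
the quotients `(A(λ) - A(αᵢ)) / (λ - αᵢ)` (`dressing_gauge`), so it is polynomial when `A` is.

In the `x` direction, `βλ + b + q` becomes `βλ + b + q + (α₁-α₂)[β,Q]`. In the `t` direction, the
new connection is the polynomial part of `h_Q T^{2j-1} h_Q⁻¹`, because the polynomial part of
`X/(λ-α)` is the divided difference at `α` of the polynomial part of `X`
(`sub_smul_polyPart_resolvent`). As a formal series, `h_Q T h_Q⁻¹` satisfies the Lax equation of the
new potential and the same algebraic equation as `T`. Hence one step preserves every condition not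
involving the bilinear form (`IsLaxFrameOn.dress`).

Since `(Im P)^⊥ = Ker P^♯` and `(Ker P)^⊥ = Im P^♯`, the second half is the step for `P^♯` with
`α₁`, `α₂` exchanged. The form is treated only after both steps. The left factor `g` is orthogonal
because `P` and `P^♯` commute, so `F̃^♯ F̃` is entire and, off `α₁`, `α₂`, equals a product of
simple factors tending to `1` at infinity. By Liouville it is `1` (`orthogonal_of_dressing`).
Comparing coefficients turns this into two identities between `π̃` and `θ` (`proj_identities`),
which make the dressed formal series skew.

Finally, differentiating the orthogonality of `F̃` puts `q̃ - q` in `o(n+1,n)`. Below the diagonal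
`[β,X]` has only two possibly nonzero entries, opposite to each other, while skewness forces them to
be equal; so `q̃` is upper triangular. The flow is the zero curvature equation of `F̃` at `λ = 0`.
-/

noncomputable section
namespace BnDarboux

/-! ### Joint smoothness of divided differences. -/

section JointSmoothness

section ParametricIntegral

open MeasureTheory


theorem continuous_slice_of_continuousOn {H : Type} [NormedAddCommGroup H]
    {G : Type} [TopologicalSpace G] {f : H × ℝ → G} {Ω : Set H}
    (hf : ContinuousOn f (Ω ×ˢ Set.univ)) {x : H} (hx : x ∈ Ω) :
    Continuous fun s => f (x, s) :=
  continuousOn_univ.mp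
    (hf.comp (by fun_prop : Continuous fun s : ℝ => (x, s)).continuousOn fun _ _ => ⟨hx, trivial⟩)

variable {H : Type} [NormedAddCommGroup H] [NormedSpace ℝ H] [ProperSpace H]

theorem hasFDerivAt_intervalIntegral {G : Type} [NormedAddCommGroup G] [NormedSpace ℝ G]
    {f : H × ℝ → G} {f' : H × ℝ → H →L[ℝ] G} {Ω : Set H} (hΩ : IsOpen Ω)
    (hf : ContinuousOn f (Ω ×ˢ Set.univ)) (hf' : ContinuousOn f' (Ω ×ˢ Set.univ))
    (hd : ∀ x ∈ Ω, ∀ s, HasFDerivAt (fun y => f (y, s)) (f' (x, s)) x) {x : H} (hx : x ∈ Ω) :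
    HasFDerivAt (fun y => ∫ s in (0 : ℝ)..1, f (y, s)) (∫ s in (0 : ℝ)..1, f' (x, s)) x := by
  obtain ⟨r, hr, hrΩ⟩ := Metric.nhds_basis_closedBall.mem_iff.mp (hΩ.mem_nhds hx)
  have hK : IsCompact (Metric.closedBall x r ×ˢ Set.Icc (0 : ℝ) 1) :=
    (isCompact_closedBall x r).prod isCompact_Icc
  obtain ⟨C, hC⟩ := hK.exists_bound_of_continuousOn
    (hf'.mono (Set.prod_mono hrΩ (Set.subset_univ _)))
  refine intervalIntegral.hasFDerivAt_integral_of_dominated_of_fderiv_le (𝕜 := ℝ)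
    (F := fun y s => f (y, s)) (F' := fun y s => f' (y, s)) (bound := fun _ => C)
    (Metric.closedBall_mem_nhds x hr) ?_ ?_ ?_ ?_ ?_ ?_
  · filter_upwards [hΩ.mem_nhds hx] with y hy
    exact (continuous_slice_of_continuousOn hf hy).aestronglyMeasurable
  · exact (continuous_slice_of_continuousOn hf hx).intervalIntegrable _ _
  · exact (continuous_slice_of_continuousOn hf' hx).aestronglyMeasurable
  · refine Filter.Eventually.of_forall fun s hs y hy => hC (y, s) ⟨hy, ?_⟩
    rw [Set.uIoc_of_le zero_le_one] at hs
    exact ⟨hs.1.le, hs.2⟩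
  · exact intervalIntegrable_const
  · exact Filter.Eventually.of_forall fun s _ y hy => hd y (hrΩ hy) s

/-- Induction on the order of differentiability. The target space is quantified inside the statement
because the induction hypothesis is applied to the partial derivative, which takes values in `H
→L[ℝ] G`. -/
theorem contDiffOn_intervalIntegral_nat (m : ℕ) {Ω : Set H} (hΩ : IsOpen Ω) :
    ∀ {G : Type} [NormedAddCommGroup G] [NormedSpace ℝ G] {f : H × ℝ → G},
      ContDiffOn ℝ ∞ f (Ω ×ˢ Set.univ) →
      ContDiffOn ℝ m (fun y => ∫ s in (0 : ℝ)..1, f (y, s)) Ω := by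
  have hO : IsOpen (Ω ×ˢ (Set.univ : Set ℝ)) := hΩ.prod isOpen_univ
  have key : ∀ {G : Type} [NormedAddCommGroup G] [NormedSpace ℝ G] {f : H × ℝ → G},
      ContDiffOn ℝ ∞ f (Ω ×ˢ Set.univ) → ∃ f' : H × ℝ → H →L[ℝ] G,
        ContDiffOn ℝ ∞ f' (Ω ×ˢ Set.univ) ∧ ∀ x ∈ Ω,
        HasFDerivAt (fun y => ∫ s in (0 : ℝ)..1, f (y, s)) (∫ s in (0 : ℝ)..1, f' (x, s)) x := by
    intro G _ _ f hf
    have h1 : ContDiffOn ℝ ∞ (fderiv ℝ f) (Ω ×ˢ Set.univ) :=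
      ((contDiffOn_infty_iff_fderiv_of_isOpen hO).mp hf).2
    have h2 : ContDiffOn ℝ ∞
        (fun w => (fderiv ℝ f w).comp (ContinuousLinearMap.inl ℝ H ℝ)) (Ω ×ˢ Set.univ) :=
      h1.clm_comp contDiffOn_const
    refine ⟨_, h2, fun x hx => hasFDerivAt_intervalIntegral hΩ hf.continuousOn h2.continuousOn
      (fun y hy s => ?_) hx⟩
    have h3 : HasFDerivAt f (fderiv ℝ f (y, s)) (y, s) :=
      ((hf.differentiableOn (by simp)).differentiableAt
        (hO.mem_nhds ⟨hy, trivial⟩)).hasFDerivAt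
    exact h3.comp y (hasFDerivAt_prodMk_left y s)
  induction m with
  | zero =>
    intro G _ _ f hf
    obtain ⟨f', -, h⟩ := key hf
    exact contDiffOn_zero.mpr fun x hx => (h x hx).continuousAt.continuousWithinAt
  | succ m ih =>
    intro G _ _ f hf
    obtain ⟨f', hf', h⟩ := key hf
    have e : ((m + 1 : ℕ) : ℕ∞ω) = (m : ℕ∞ω) + 1 := by norm_cast
    rw [e, contDiffOn_succ_iff_fderiv_of_isOpen hΩ]
    refine ⟨fun x hx => (h x hx).differentiableAt.differentiableWithinAt,
      fun h' => absurd h' (by simp), ?_⟩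
    exact (ih hf').congr fun x hx => (h x hx).fderiv

theorem contDiffOn_intervalIntegral {Ω : Set H} (hΩ : IsOpen Ω) {G : Type}
    [NormedAddCommGroup G] [NormedSpace ℝ G] {f : H × ℝ → G}
    (hf : ContDiffOn ℝ ∞ f (Ω ×ˢ Set.univ)) :
    ContDiffOn ℝ ∞ (fun y => ∫ s in (0 : ℝ)..1, f (y, s)) Ω :=
  contDiffOn_infty.mpr fun m => contDiffOn_intervalIntegral_nat m hΩ hf

/-- Divided differences of a family of entire functions that is jointly smooth are jointly
smooth. -/
theorem contDiffOn_dslope {E : Type} [NormedAddCommGroup E] [NormedSpace ℝ E] [ProperSpace E]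
    {Ω : Set E} (hΩ : IsOpen Ω) {f : E → ℂ → ℂ} (a : ℂ)
    (hf : ContDiffOn ℝ ∞ (fun w : E × ℂ => f w.1 w.2) (Ω ×ˢ Set.univ))
    (hd : ∀ p ∈ Ω, Differentiable ℂ (f p)) :
    ContDiffOn ℝ ∞ (fun w : E × ℂ => dslope (f w.1) a w.2) (Ω ×ˢ Set.univ) := by
  have hO : IsOpen (Ω ×ˢ (Set.univ : Set ℂ)) := hΩ.prod isOpen_univ
  set g : E × ℂ → ℂ := fun w => f w.1 w.2
  -- The complex derivative in `z` is the real derivative in the direction `(0, 1)`, hence jointly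
  -- smooth.
  have hder : ∀ w ∈ Ω ×ˢ (Set.univ : Set ℂ), fderiv ℝ g w (0, 1) = deriv (f w.1) w.2 := by
    rintro ⟨p, z⟩ ⟨hp, -⟩
    have h3 : HasFDerivAt g (fderiv ℝ g (p, z)) (p, z) :=
      ((hf.differentiableOn (by simp)).differentiableAt
        (hO.mem_nhds ⟨hp, trivial⟩)).hasFDerivAt
    have h4 : HasFDerivAt (f p) ((fderiv ℝ g (p, z)).comp (ContinuousLinearMap.inr ℝ E ℂ)) z :=
      HasFDerivAt.comp (g := g) z h3 (hasFDerivAt_prodMk_right p z)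
    have h5 := ((hd p hp z).hasDerivAt.hasFDerivAt.restrictScalars ℝ).unique h4
    have h6 := congrArg (fun L : ℂ →L[ℝ] ℂ => L 1) h5
    simpa using h6.symm
  have h1 : ContDiffOn ℝ ∞ (fun w => deriv (f w.1) w.2) (Ω ×ˢ (Set.univ : Set ℂ)) := by
    have h2 : ContDiffOn ℝ ∞ (fun w => fderiv ℝ g w (0, 1)) (Ω ×ˢ (Set.univ : Set ℂ)) :=
      ((contDiffOn_infty_iff_fderiv_of_isOpen hO).mp hf).2.clm_apply contDiffOn_const
    exact h2.congr fun w hw => (hder w hw).symm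
  -- Integrand of Hadamard's formula: the divided difference is the integral of `f'(a + s(z - a))`
  -- over `s ∈ [0,1]`, which also covers `z = a`.
  have h2 : ContDiffOn ℝ ∞
      (fun y : (E × ℂ) × ℝ => deriv (f y.1.1) (a + y.2 • (y.1.2 - a)))
      ((Ω ×ˢ (Set.univ : Set ℂ)) ×ˢ Set.univ) :=
    h1.comp (f := fun y : (E × ℂ) × ℝ => (y.1.1, a + y.2 • (y.1.2 - a)))
      (by fun_prop) fun y hy => ⟨hy.1.1, trivial⟩
  refine (contDiffOn_intervalIntegral hO h2).congr ?_
  rintro ⟨p, z⟩ ⟨hp, -⟩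
  have hc : Continuous (deriv (f p)) := ((hd p hp).contDiff (n := 1)).continuous_deriv le_rfl
  by_cases hz : z = a
  · subst hz
    simp
  · have hza : z - a ≠ 0 := sub_ne_zero.mpr hz
    have hline : ∀ s : ℝ, HasDerivAt (fun s : ℝ => f p (a + s • (z - a)))
        (deriv (f p) (a + s • (z - a)) * (z - a)) s := by
      intro s
      have h7 : HasDerivAt (fun s : ℝ => a + s • (z - a)) (z - a) s := by
        simpa using ((hasDerivAt_id s).smul_const (z - a)).const_add a
      exact ((hd p hp _).hasDerivAt).comp s h7
    have h8 := intervalIntegral.integral_eq_sub_of_hasDerivAt (a := 0) (b := 1)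
      (fun s _ => hline s) ((by fun_prop : Continuous fun s : ℝ =>
        deriv (f p) (a + s • (z - a)) * (z - a)).intervalIntegrable _ _)
    simp only [intervalIntegral.integral_mul_const, one_smul, zero_smul, add_zero,
      add_sub_cancel] at h8
    rw [dslope_of_ne _ hz, slope_def_field, eq_comm, eq_div_iff hza]
    exact h8

end ParametricIntegral
end JointSmoothness

/-! ### Algebra of the simple factors, entrywise calculus of matrices, pulled back projections. -/

section Calculus

section Algebra

variable {R A : Type*} [CommRing R] [Ring A] [Algebra R A]

/-- The hypothesis says `(1 + u)(1 + v) = 1`, so for idempotent `e` the factors `1 + u e` and `1 + v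
e` are inverse to each other. It removes the product `u v`, which leaves a partial fraction
expansion when `u`, `v` have simple poles at different points. -/
theorem dressing_expand {u v : R} (h : u * v = -(u + v)) (X e f : A) :
    (1 + u • e) * X * (1 + v • f) = X + u • (e * X * (1 - f)) + v • ((1 - e) * X * f) := by
  have h1 : (1 + u • e) * X * (1 + v • f)
      = X + u • (e * X) + v • (X * f) + (u * v) • (e * X * f) := by
    simp only [add_mul, mul_add, one_mul, mul_one, smul_mul_assoc, mul_smul_comm, smul_add,
      mul_smul, smul_comm v u]
    abel
  rw [h1, h]
  simp only [mul_sub, sub_mul, mul_one, one_mul, smul_sub, neg_smul, add_smul]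
  abel

theorem one_add_smul_mul_one_add_smul {u v : R} (h : u * v = -(u + v)) {e : A} (he : e * e = e) :
    (1 + u • e) * (1 + v • e) = 1 := by
  have := dressing_expand h 1 e e
  simpa [mul_sub, sub_mul, he] using this

/-- The gauge transformation of a connection `X` by `1 + u (1 - π)`. -/
theorem dressing_gauge {u v : R} (h : u * v = -(u + v)) {p X X₁ X₂ D : A} (hp : p * p = p)
    (hD : D = p * X₂ * (1 - p) - (1 - p) * X₁ * p) :
    (1 + u • (1 - p)) * X * (1 + v • (1 - p)) + u • (D * (1 + v • (1 - p)))
      = X + u • ((1 - p) * (X - X₁) * p) + v • (p * (X - X₂) * (1 - p)) := by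
  have h0 : p * (1 - p) = 0 := by rw [mul_sub, mul_one, hp, sub_self]
  have h1 : (1 - p) * (1 - p) = 1 - p := by rw [sub_mul, h0, one_mul, sub_zero]
  -- `D` is the derivative of the projection, so the added term is `-H_x H⁻¹` for `H = 1 + u (1 -
  -- p)`. Its two off-diagonal blocks supply the subtractions of `X₁` and `X₂`.
  have h2 : D * (1 - p) = p * X₂ * (1 - p) := by
    rw [hD, sub_mul, mul_assoc _ (1 - p) (1 - p), h1, mul_assoc _ p (1 - p), h0, mul_zero,
      sub_zero]
  rw [dressing_expand h, sub_sub_cancel, mul_add, mul_one, mul_smul_comm, h2, smul_add, smul_smul,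
    h, hD]
  simp only [mul_sub, sub_mul, smul_sub, neg_smul, add_smul, mul_one, one_mul]
  abel

end Algebra

section MatrixCalculus

variable {ι : Type*} [Fintype ι] {R : Type*} [NormedRing R] [NormedAlgebra ℝ R]

/-- Entrywise derivative of a curve of matrices. -/
def HasMatrixDerivAt (f : ℝ → Matrix ι ι R) (f' : Matrix ι ι R) (s : ℝ) : Prop :=
  ∀ a b, HasDerivAt (fun u => f u a b) (f' a b) s

namespace HasMatrixDerivAt

variable {f g : ℝ → Matrix ι ι R} {f' g' : Matrix ι ι R} {s : ℝ}

omit [Fintype ι] in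
theorem const (X : Matrix ι ι R) : HasMatrixDerivAt (fun _ => X) 0 s := fun _ _ =>
  hasDerivAt_const _ _

omit [Fintype ι] in
theorem unique (hf : HasMatrixDerivAt f f' s) (hg : HasMatrixDerivAt f g' s) : f' = g' := by
  ext a b
  exact (hf a b).unique (hg a b)

omit [Fintype ι] in
theorem add (hf : HasMatrixDerivAt f f' s) (hg : HasMatrixDerivAt g g' s) :
    HasMatrixDerivAt (fun u => f u + g u) (f' + g') s := fun a b => (hf a b).add (hg a b)

omit [Fintype ι] in
theorem sub (hf : HasMatrixDerivAt f f' s) (hg : HasMatrixDerivAt g g' s) :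
    HasMatrixDerivAt (fun u => f u - g u) (f' - g') s := fun a b => (hf a b).sub (hg a b)

omit [Fintype ι] in
theorem const_smul (c : R) (hf : HasMatrixDerivAt f f' s) :
    HasMatrixDerivAt (fun u => c • f u) (c • f') s := fun a b => (hf a b).const_mul c

theorem mul (hf : HasMatrixDerivAt f f' s) (hg : HasMatrixDerivAt g g' s) :
    HasMatrixDerivAt (fun u => f u * g u) (f' * g s + f s * g') s := by
  intro a b
  simp only [Matrix.mul_apply, Matrix.add_apply, ← Finset.sum_add_distrib]
  exact HasDerivAt.fun_sum fun c _ => (hf a c).mul (hg c b)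

omit [Fintype ι] in
theorem congr_of_eventuallyEq (hf : HasMatrixDerivAt f f' s) (h : g =ᶠ[𝓝 s] f) :
    HasMatrixDerivAt g f' s := fun a b =>
  (hf a b).congr_of_eventuallyEq (h.mono fun u hu => by simp only [hu])

end HasMatrixDerivAt

theorem HasMatrixDerivAt.cx {n : ℕ} {f : ℝ → RMat n} {f' : RMat n} {s : ℝ}
    (hf : HasMatrixDerivAt f f' s) :
    HasMatrixDerivAt (fun u => BnDarboux.cx (f u)) (BnDarboux.cx f') s :=
  fun a b => (hf a b).ofReal_comp

end MatrixCalculus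

section SmoothMatrix

variable {E : Type*} [NormedAddCommGroup E] [NormedSpace ℝ E] {ι : Type*}
  {𝕜 : Type*} [NormedField 𝕜] [NormedAlgebra ℝ 𝕜]

/-- Entrywise smoothness of a matrix function. -/
def SmoothMatOn (Ω : Set E) (f : E → Matrix ι ι 𝕜) : Prop :=
  ∀ a b, ContDiffOn ℝ ∞ (fun p => f p a b) Ω

namespace SmoothMatOn

variable {Ω : Set E} {f g : E → Matrix ι ι 𝕜}

theorem const (X : Matrix ι ι 𝕜) : SmoothMatOn Ω fun _ : E => X := fun _ _ => contDiffOn_const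

theorem add (hf : SmoothMatOn Ω f) (hg : SmoothMatOn Ω g) :
    SmoothMatOn Ω fun p => f p + g p := fun a b => (hf a b).add (hg a b)

theorem sub (hf : SmoothMatOn Ω f) (hg : SmoothMatOn Ω g) :
    SmoothMatOn Ω fun p => f p - g p := fun a b => (hf a b).sub (hg a b)

theorem const_smul (c : 𝕜) (hf : SmoothMatOn Ω f) :
    SmoothMatOn Ω fun p => c • f p := fun a b => contDiffOn_const.mul (hf a b)

theorem mono {Ω' : Set E} (hf : SmoothMatOn Ω f) (h : Ω' ⊆ Ω) : SmoothMatOn Ω' f :=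
  fun a b => (hf a b).mono h

theorem congr (hf : SmoothMatOn Ω f) (h : ∀ p ∈ Ω, g p = f p) : SmoothMatOn Ω g :=
  fun a b => (hf a b).congr fun p hp => by rw [h p hp]

theorem comp {E' : Type*} [NormedAddCommGroup E'] [NormedSpace ℝ E'] {Ω' : Set E'} {φ : E' → E}
    (hf : SmoothMatOn Ω f) (hφ : ContDiff ℝ ∞ φ) (h : Set.MapsTo φ Ω' Ω) :
    SmoothMatOn Ω' fun p => f (φ p) := fun a b => (hf a b).comp hφ.contDiffOn h

variable [Fintype ι]

theorem mul (hf : SmoothMatOn Ω f) (hg : SmoothMatOn Ω g) :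
    SmoothMatOn Ω fun p => f p * g p := fun a b => by
  simp only [Matrix.mul_apply]
  exact ContDiffOn.sum fun c _ => (hf a c).mul (hg c b)

variable [DecidableEq ι]

theorem det (hf : SmoothMatOn Ω f) : ContDiffOn ℝ ∞ (fun p => (f p).det) Ω := by
  simp only [Matrix.det_apply']
  exact ContDiffOn.sum fun σ _ => contDiffOn_const.mul (contDiffOn_prod fun i _ => hf (σ i) i)

theorem inv (hf : SmoothMatOn Ω f) (h : ∀ p ∈ Ω, (f p).det ≠ 0) :
    SmoothMatOn Ω fun p => (f p)⁻¹ := by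
  intro a b
  have h1 : ContDiffOn ℝ ∞ (fun p => (f p).adjugate a b) Ω := by
    simp only [Matrix.adjugate_apply]
    refine det fun i j => ?_
    by_cases hi : i = b
    · subst hi
      simp only [Matrix.updateRow_self]
      exact contDiffOn_const
    · simp only [Matrix.updateRow_ne hi]
      exact hf i j
  refine (((hf.det).inv h).mul h1).congr fun p hp => ?_
  simp [Matrix.inv_def]

end SmoothMatOn

theorem SmoothMatOn.cx {n : ℕ} {E : Type*} [NormedAddCommGroup E] [NormedSpace ℝ E] {Ω : Set E}
    {f : E → RMat n} (hf : SmoothMatOn Ω f) : SmoothMatOn Ω fun p => BnDarboux.cx (f p) :=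
  fun a b => Complex.ofRealCLM.contDiff.comp_contDiffOn (hf a b)

end SmoothMatrix

section RealComplex

variable {n : ℕ}

theorem cx_eq (A : RMat n) : cx A = Complex.ofRealHom.mapMatrix A := rfl

@[simp] theorem cx_apply (A : RMat n) (a b) : cx A a b = (A a b : ℂ) := rfl

@[simp] theorem cx_zero : cx (0 : RMat n) = 0 := by simp [cx_eq]

@[simp] theorem cx_one : cx (1 : RMat n) = 1 := by simp only [cx_eq, map_one]

theorem cx_mul (A B : RMat n) : cx (A * B) = cx A * cx B := by simp only [cx_eq, map_mul]

theorem cx_add (A B : RMat n) : cx (A + B) = cx A + cx B := by simp only [cx_eq, map_add]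

theorem cx_sub (A B : RMat n) : cx (A - B) = cx A - cx B := by simp only [cx_eq, map_sub]

theorem cx_smul (r : ℝ) (A : RMat n) : cx (r • A) = (r : ℂ) • cx A := by ext; simp

theorem cx_transpose (A : RMat n) : cx Aᵀ = (cx A)ᵀ := rfl

theorem cx_injective : Function.Injective (cx (n := n)) := fun A B h => by
  ext a b
  have := congrFun (congrFun h a) b
  simpa using this

theorem cx_det (A : RMat n) : (cx A).det = (A.det : ℂ) := by
  rw [cx_eq, ← RingHom.map_det]; rfl

theorem cx_map_re {A : CMat n} (h : A.map (starRingEnd ℂ) = A) : cx (A.map Complex.re) = A := by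
  ext a b
  have := congrFun (congrFun h a) b
  simpa using Complex.conj_eq_iff_re.mp this

theorem cx_mulVec (A : RMat n) (v : RVec n) :
    cx A *ᵥ (fun i => (v i : ℂ)) = fun i => ((A *ᵥ v) i : ℂ) := by
  ext i
  simp [Matrix.mulVec, dotProduct]

theorem invImage_cx (A : RMat n) (V : Submodule ℝ (RVec n)) :
    invImage (cx A) V = V.comap (Matrix.toLin' A) := by
  ext v
  change (∃ w ∈ V, _) ↔ A *ᵥ v ∈ V
  rw [cx_mulVec]
  constructor
  · rintro ⟨w, hw, h⟩
    have : A *ᵥ v = w := by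
      ext i
      have := congrFun h i
      simpa using this
    rwa [this]
  · exact fun h => ⟨_, h, rfl⟩

end RealComplex

section Projection

variable {n : ℕ}

theorem mem_im_iff {P : RMat n} (hP : P * P = P) (v : RVec n) : v ∈ im P ↔ P *ᵥ v = v := by
  constructor
  · rintro ⟨w, rfl⟩
    rw [Matrix.toLin'_apply, Matrix.mulVec_mulVec, hP]
  · exact fun h => ⟨v, h⟩

theorem mem_ker_iff {P : RMat n} (v : RVec n) : v ∈ ker P ↔ P *ᵥ v = 0 := Iff.rfl

theorem projAlong_eq {V W : Submodule ℝ (RVec n)} {Q : RMat n}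
    (hV : ∀ v, v ∈ V ↔ Q *ᵥ v = v) (hW : ∀ v, v ∈ W ↔ Q *ᵥ v = 0) (hQ : Q * Q = Q) :
    IsCompl V W ∧ projAlong V W = Q := by
  have hQQ : ∀ v, Q *ᵥ (Q *ᵥ v) = Q *ᵥ v := fun v => by rw [Matrix.mulVec_mulVec, hQ]
  have hc : IsCompl V W := by
    refine ⟨Submodule.disjoint_def.mpr fun v h1 h2 => ?_, codisjoint_iff.mpr ?_⟩
    · rw [← (hV v).mp h1, (hW v).mp h2]
    · refine eq_top_iff.mpr fun v _ => ?_
      have : v = Q *ᵥ v + (v - Q *ᵥ v) := by abel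
      rw [this]
      exact Submodule.add_mem_sup ((hV _).mpr (hQQ v))
        ((hW _).mpr (by rw [Matrix.mulVec_sub, hQQ, sub_self]))
  refine ⟨hc, ?_⟩
  rw [projAlong, dif_pos hc]
  apply Matrix.toLin'.injective
  rw [Matrix.toLin'_toMatrix']
  refine LinearMap.ext fun v => ?_
  have h1 : Q *ᵥ v ∈ V := (hV _).mpr (hQQ v)
  have h2 : v - Q *ᵥ v ∈ W := (hW _).mpr (by rw [Matrix.mulVec_sub, hQQ, sub_self])
  have h3 : v = Q *ᵥ v + (v - Q *ᵥ v) := by abel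
  conv_lhs => rw [h3]
  rw [map_add, Submodule.projection_apply_of_mem_left hc h1, Matrix.toLin'_apply,
    Submodule.projection_apply, (Submodule.projectionOnto_apply_eq_zero_iff hc).mpr h2]
  simp

/-- `Q` is the projection onto `K₁⁻¹(Im P)` along `K₂⁻¹(Ker P)`. -/
structure IsPullbackProj (K₁ K₂ P Q : RMat n) : Prop where
  idem : Q * Q = Q
  left : (1 - P) * K₁ * Q = 0
  right : P * K₂ * (1 - Q) = 0
  left_cancel : ∀ Y : RMat n, (1 - P) * K₁ * Y = 0 → (1 - Q) * Y = 0
  right_cancel : ∀ Y : RMat n, P * K₂ * Y = 0 → Q * Y = 0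

/-- The matrix that maps `Im P` to `K₁⁻¹(Im P)` and `Ker P` to `K₂⁻¹(Ker P)`. -/
def pullbackBasis (K₁ K₂ P : RMat n) : RMat n := K₁⁻¹ * P + K₂⁻¹ * (1 - P)

variable {K₁ K₂ P : RMat n}

theorem pullbackBasis_mul (hP : P * P = P) : pullbackBasis K₁ K₂ P * P = K₁⁻¹ * P := by
  rw [pullbackBasis, add_mul, mul_assoc, mul_assoc, sub_mul, hP, one_mul, sub_self, mul_zero,
    add_zero]

theorem pullbackBasis_mul_compl (hP : P * P = P) :
    pullbackBasis K₁ K₂ P * (1 - P) = K₂⁻¹ * (1 - P) := by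
  rw [mul_sub, mul_one, pullbackBasis_mul hP, pullbackBasis, add_sub_cancel_left]

/-- A kernel vector `v` satisfies `K₁⁻¹ P v = -K₂⁻¹ (1 - P) v`, a vector lying in both subspaces.
Trivial intersection therefore suffices, and complementarity follows from the invertibility. -/
theorem isUnit_det_pullbackBasis (hP : P * P = P) (h₁ : IsUnit K₁.det) (h₂ : IsUnit K₂.det)
    (hd : invImage (cx K₁) (im P) ⊓ invImage (cx K₂) (ker P) = ⊥) :
    IsUnit (pullbackBasis K₁ K₂ P).det := by
  rw [isUnit_iff_ne_zero]
  intro h0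
  obtain ⟨v, hv0, hv⟩ := Matrix.exists_mulVec_eq_zero_iff.mpr h0
  apply hv0
  have h3 : K₁⁻¹ *ᵥ (P *ᵥ v) = -(K₂⁻¹ *ᵥ ((1 - P) *ᵥ v)) := by
    rw [pullbackBasis, Matrix.add_mulVec, ← Matrix.mulVec_mulVec, ← Matrix.mulVec_mulVec] at hv
    exact eq_neg_of_add_eq_zero_left hv
  have h4 : K₁⁻¹ *ᵥ (P *ᵥ v) ∈ invImage (cx K₁) (im P) ⊓ invImage (cx K₂) (ker P) := by
    rw [invImage_cx, invImage_cx]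
    constructor
    · change K₁ *ᵥ _ ∈ im P
      rw [Matrix.mulVec_mulVec, Matrix.mul_nonsing_inv _ h₁, Matrix.one_mulVec]
      exact ⟨v, rfl⟩
    · change K₂ *ᵥ _ ∈ ker P
      rw [h3, Matrix.mulVec_neg, Matrix.mulVec_mulVec, Matrix.mul_nonsing_inv _ h₂,
        Matrix.one_mulVec, mem_ker_iff, Matrix.mulVec_neg, Matrix.mulVec_mulVec, mul_sub, mul_one,
        hP, sub_self, Matrix.zero_mulVec, neg_zero]
  rw [hd, Submodule.mem_bot] at h4
  have h5 : P *ᵥ v = 0 := by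
    have := congrArg (K₁ *ᵥ ·) h4
    simpa [Matrix.mulVec_mulVec, ← mul_assoc, Matrix.mul_nonsing_inv _ h₁] using this
  have h6 : (1 - P) *ᵥ v = 0 := by
    have := congrArg (K₂ *ᵥ ·) (h3.symm.trans h4)
    simpa [Matrix.mulVec_neg, Matrix.mulVec_mulVec, ← mul_assoc, Matrix.mul_nonsing_inv _ h₂]
      using this
  rw [Matrix.sub_mulVec, Matrix.one_mulVec, h5, sub_zero] at h6
  exact h6

/-- The explicit formula `R P R⁻¹` yields smoothness of the projection, and its conjugacy to `P`
later yields the determinant. -/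
theorem isPullbackProj_pullbackBasis (hP : P * P = P) (h₁ : IsUnit K₁.det) (h₂ : IsUnit K₂.det)
    (hR : IsUnit (pullbackBasis K₁ K₂ P).det) :
    IsPullbackProj K₁ K₂ P (pullbackBasis K₁ K₂ P * P * (pullbackBasis K₁ K₂ P)⁻¹) := by
  set R := pullbackBasis K₁ K₂ P with hRdef
  have hRR : R * R⁻¹ = 1 := Matrix.mul_nonsing_inv _ hR
  have hRR' : R⁻¹ * R = 1 := Matrix.nonsing_inv_mul _ hR
  have hK₁ : K₁ * K₁⁻¹ = 1 := Matrix.mul_nonsing_inv _ h₁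
  have hK₁' : K₁⁻¹ * K₁ = 1 := Matrix.nonsing_inv_mul _ h₁
  have hK₂ : K₂ * K₂⁻¹ = 1 := Matrix.mul_nonsing_inv _ h₂
  have hK₂' : K₂⁻¹ * K₂ = 1 := Matrix.nonsing_inv_mul _ h₂
  have e1 : R * P = K₁⁻¹ * P := pullbackBasis_mul hP
  have e2 : R * (1 - P) = K₂⁻¹ * (1 - P) := pullbackBasis_mul_compl hP
  have hc : 1 - R * P * R⁻¹ = R * (1 - P) * R⁻¹ := by
    rw [mul_sub, sub_mul, mul_one, hRR]
  have hPc : (1 - P) * P = 0 := by rw [sub_mul, hP, one_mul, sub_self]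
  have hPc' : P * (1 - P) = 0 := by rw [mul_sub, hP, mul_one, sub_self]
  have idem : R * P * R⁻¹ * (R * P) = R * P := by
    rw [mul_assoc (R * P), ← mul_assoc R⁻¹, hRR', one_mul, mul_assoc, hP]
  have idem' : R * P * R⁻¹ * (R * (1 - P)) = 0 := by
    rw [mul_assoc (R * P), ← mul_assoc R⁻¹, hRR', one_mul, mul_assoc, hPc', mul_zero]
  refine ⟨?_, ?_, ?_, fun Y hY => ?_, fun Y hY => ?_⟩
  · rw [← mul_assoc, idem]
  · rw [e1, ← mul_assoc, ← mul_assoc, mul_assoc (1 - P), hK₁, mul_one, hPc, zero_mul]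
  · rw [hc, e2, ← mul_assoc, ← mul_assoc, mul_assoc P, hK₂, mul_one, hPc', zero_mul]
  · rw [mul_assoc, sub_mul, one_mul, sub_eq_zero] at hY
    have hY' : Y = R * P * (K₁ * Y) := by
      rw [e1, mul_assoc, ← hY, ← mul_assoc, hK₁', one_mul]
    rw [hY', ← mul_assoc, sub_mul, idem, one_mul, sub_self, zero_mul]
  · rw [mul_assoc] at hY
    have hY' : Y = R * (1 - P) * (K₂ * Y) := by
      rw [e2, mul_assoc, sub_mul, hY, one_mul, sub_zero, ← mul_assoc, hK₂', one_mul]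
    rw [hY', ← mul_assoc, idem', zero_mul]

theorem IsPullbackProj.projAlong_eq {Q : RMat n} (hP : P * P = P) (h : IsPullbackProj K₁ K₂ P Q) :
    IsCompl (invImage (cx K₁) (im P)) (invImage (cx K₂) (ker P)) ∧
      projAlong (invImage (cx K₁) (im P)) (invImage (cx K₂) (ker P)) = Q := by
  -- The matrix with all columns equal to `v` lets the matrix cancellation laws be applied to a
  -- single vector.
  have key : ∀ v : RVec n, ∃ Y : RMat n, ∀ X : RMat n, X * Y = 0 ↔ X *ᵥ v = 0 := by
    intro v
    refine ⟨Matrix.of fun i _ => v i, fun X => ⟨fun hX => ?_, fun hX => ?_⟩⟩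
    · ext i
      exact congrFun (congrFun hX i) 0
    · ext i k
      exact congrFun hX i
  refine BnDarboux.projAlong_eq (fun v => ?_) (fun v => ?_) h.idem
  · rw [invImage_cx, Submodule.mem_comap, mem_im_iff hP, Matrix.toLin'_apply]
    constructor
    · intro hv
      obtain ⟨Y, hY⟩ := key v
      have := h.left_cancel Y ((hY _).mpr (by
        rw [← Matrix.mulVec_mulVec, Matrix.sub_mulVec, hv, Matrix.one_mulVec, sub_self]))
      rw [hY, Matrix.sub_mulVec, Matrix.one_mulVec, sub_eq_zero] at this
      exact this.symm
    · intro hv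
      have := congrArg (· *ᵥ v) h.left
      simp only [← Matrix.mulVec_mulVec, Matrix.zero_mulVec, hv] at this
      rw [Matrix.sub_mulVec, Matrix.one_mulVec, sub_eq_zero] at this
      exact this.symm
  · rw [invImage_cx, Submodule.mem_comap, mem_ker_iff, Matrix.toLin'_apply]
    constructor
    · intro hv
      obtain ⟨Y, hY⟩ := key v
      exact (hY _).mp (h.right_cancel Y ((hY _).mpr (by rw [← Matrix.mulVec_mulVec, hv])))
    · intro hv
      have := congrArg (· *ᵥ v) h.right
      simpa [← Matrix.mulVec_mulVec, Matrix.zero_mulVec, Matrix.sub_mulVec, hv] using this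

/-- The differential equation of the pulled back projection. -/
theorem IsPullbackProj.hasMatrixDerivAt {K₁ K₂ Q : ℝ → RMat n} {P A₁ A₂ Q' : RMat n} {s : ℝ}
    (h : ∀ᶠ u in 𝓝 s, IsPullbackProj (K₁ u) (K₂ u) P (Q u))
    (hK₁ : HasMatrixDerivAt K₁ (K₁ s * A₁) s) (hK₂ : HasMatrixDerivAt K₂ (K₂ s * A₂) s)
    (hQ : HasMatrixDerivAt Q Q' s) :
    Q' = Q s * A₂ * (1 - Q s) - (1 - Q s) * A₁ * Q s := by
  have h0 := h.self_of_nhds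
  -- Differentiating `(1 - P) K₁ Q = 0` and `P K₂ (1 - Q) = 0` and cancelling determines `(1 - Q)
  -- Q'` and `Q Q'`; their sum is `Q'`.
  have e1 : (1 - P) * K₁ s * (A₁ * Q s + Q') = 0 := by
    have d1 := ((HasMatrixDerivAt.const (1 - P)).mul hK₁).mul hQ
    have d2 := (HasMatrixDerivAt.const (0 : RMat n) (s := s)).congr_of_eventuallyEq
      (h.mono fun u hu => hu.left)
    have := d1.unique d2
    rw [← this]
    noncomm_ring
  have e2 : P * K₂ s * (A₂ * (1 - Q s) - Q') = 0 := by
    have d1 := ((HasMatrixDerivAt.const P).mul hK₂).mul ((HasMatrixDerivAt.const 1).sub hQ)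
    have d2 := (HasMatrixDerivAt.const (0 : RMat n) (s := s)).congr_of_eventuallyEq
      (h.mono fun u hu => hu.right)
    have := d1.unique d2
    rw [← this]
    noncomm_ring
  have e3 := h0.left_cancel _ e1
  have e4 := h0.right_cancel _ e2
  have e5 : Q s * A₂ * (1 - Q s) = Q s * Q' := by
    rw [mul_sub, sub_eq_zero] at e4
    rw [mul_assoc, e4]
  have e6 : (1 - Q s) * A₁ * Q s = -((1 - Q s) * Q') := by
    rw [mul_add] at e3
    rw [mul_assoc]
    exact eq_neg_of_add_eq_zero_left e3
  rw [e5, e6]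
  noncomm_ring

end Projection
end Calculus

/-! ### The Darboux step for entire families. -/

section AnalyticDressing

/-- Both sides are the derivative of `H' = H⁻¹`, with `H = 1 + u (1 - p)` and `H' = 1 + v (1 - p)`:
once as `-H' H_x H'`, once directly. -/
theorem dressing_deriv {R A : Type*} [CommRing R] [Ring A] [Algebra R A] {u v : R}
    (h : u * v = -(u + v)) {p X₁ X₂ D : A} (hp : p * p = p)
    (hD : D = p * X₂ * (1 - p) - (1 - p) * X₁ * p) :
    u • ((1 + v • (1 - p)) * (D * (1 + v • (1 - p)))) = -(v • D) := by
  have h0 : p * (1 - p) = 0 := by rw [mul_sub, mul_one, hp, sub_self]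
  have h0' : (1 - p) * p = 0 := by rw [sub_mul, one_mul, hp, sub_self]
  have h1 : (1 - p) * (1 - p) = 1 - p := by rw [sub_mul, h0, one_mul, sub_zero]
  have h2 : D * (1 - p) = p * X₂ * (1 - p) := by
    rw [hD, sub_mul, mul_assoc _ (1 - p) (1 - p), h1, mul_assoc _ p (1 - p), h0, mul_zero,
      sub_zero]
  have h3 : (1 - p) * D = D - p * X₂ * (1 - p) := by
    rw [hD, mul_sub, ← mul_assoc, ← mul_assoc, h0', zero_mul, zero_mul, ← mul_assoc, ← mul_assoc,
      h1]
    abel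
  have h4 : (1 - p) * (D * (1 - p)) = 0 := by
    rw [h2, ← mul_assoc, ← mul_assoc, h0', zero_mul, zero_mul]
  have h5 : (1 + v • (1 - p)) * (D * (1 + v • (1 - p))) = D + v • D := by
    rw [mul_add, mul_one, mul_add, add_mul, one_mul, smul_mul_assoc, h3, mul_smul_comm,
      mul_smul_comm, add_mul, smul_mul_assoc, h4, h2]
    simp only [smul_sub, smul_zero, add_zero, one_mul]
    abel
  rw [h5, smul_add, smul_smul, h]
  simp only [neg_smul, add_smul]
  abel

variable {n : ℕ}

/-- A smooth family of entire, invertible matrix functions satisfying the reality condition. -/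
structure IsRealLoopFamilyOn (Ω : Set (ℝ × ℝ)) (K : ℝ × ℝ → ℂ → CMat n) : Prop where
  smooth : SmoothMatOn (Ω ×ˢ Set.univ) fun w : (ℝ × ℝ) × ℂ => K w.1 w.2
  holo : ∀ p ∈ Ω, ∀ a b, Differentiable ℂ fun z => K p z a b
  det : ∀ p ∈ Ω, ∀ z, IsUnit (K p z).det
  real : ∀ p ∈ Ω, ∀ z, (K p (starRingEnd ℂ z)).map (starRingEnd ℂ) = K p z

/-- The value of a real loop family at a real parameter, as a real matrix. -/
def realValue (K : ℝ × ℝ → ℂ → CMat n) (α : ℝ) (p : ℝ × ℝ) : RMat n := (K p α).map Complex.re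

namespace IsRealLoopFamilyOn

variable {Ω : Set (ℝ × ℝ)} {K : ℝ × ℝ → ℂ → CMat n}

theorem mono {Ω' : Set (ℝ × ℝ)} (h : IsRealLoopFamilyOn Ω K) (hs : Ω' ⊆ Ω) :
    IsRealLoopFamilyOn Ω' K :=
  ⟨h.smooth.mono (Set.prod_mono hs subset_rfl), fun p hp => h.holo p (hs hp),
    fun p hp => h.det p (hs hp), fun p hp => h.real p (hs hp)⟩

theorem congr {K' : ℝ × ℝ → ℂ → CMat n} (h : IsRealLoopFamilyOn Ω K)
    (e : ∀ p ∈ Ω, K' p = K p) : IsRealLoopFamilyOn Ω K' :=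
  ⟨h.smooth.congr fun w hw => by rw [e w.1 hw.1], fun p hp => by rw [e p hp]; exact h.holo p hp,
    fun p hp => by rw [e p hp]; exact h.det p hp, fun p hp => by rw [e p hp]; exact h.real p hp⟩

theorem continuous (h : IsRealLoopFamilyOn Ω K) {p : ℝ × ℝ} (hp : p ∈ Ω) : Continuous (K p) :=
  continuous_matrix fun a b => (h.holo p hp a b).continuous

theorem cx_realValue (h : IsRealLoopFamilyOn Ω K) {p : ℝ × ℝ} (hp : p ∈ Ω) (α : ℝ) :
    cx (realValue K α p) = K p α :=
  cx_map_re (by simpa using h.real p hp α)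

theorem isUnit_det_realValue (h : IsRealLoopFamilyOn Ω K) {p : ℝ × ℝ} (hp : p ∈ Ω) (α : ℝ) :
    IsUnit (realValue K α p).det := by
  have := h.det p hp α
  rw [← h.cx_realValue hp, cx_det, isUnit_iff_ne_zero] at this
  exact isUnit_iff_ne_zero.mpr (by exact_mod_cast this)

theorem smooth_apply (h : IsRealLoopFamilyOn Ω K) (z : ℂ) : SmoothMatOn Ω fun p => K p z :=
  h.smooth.comp (φ := fun p : ℝ × ℝ => (p, z)) (by fun_prop) fun _ hp => ⟨hp, trivial⟩

theorem smooth_realValue (h : IsRealLoopFamilyOn Ω K) (α : ℝ) : SmoothMatOn Ω (realValue K α) :=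
  fun a b => Complex.reCLM.contDiff.comp_contDiffOn (h.smooth_apply α a b)

/-- Continuity in `z` is the point: formulas for the derivative found off `α₁`, `α₂` extend to these
two values. -/
theorem exists_hasMatrixDerivAt (h : IsRealLoopFamilyOn Ω K) (hΩ : IsOpen Ω) {γ : ℝ → ℝ × ℝ}
    {v : ℝ × ℝ} {s : ℝ} (hγ : HasDerivAt γ v s) (hs : γ s ∈ Ω) :
    ∃ D : ℂ → CMat n, Continuous D ∧ ∀ z, HasMatrixDerivAt (fun u => K (γ u) z) (D z) s := by
  have hO : IsOpen (Ω ×ˢ (Set.univ : Set ℂ)) := hΩ.prod isOpen_univ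
  refine ⟨fun z => Matrix.of fun a b =>
    fderiv ℝ (fun w : (ℝ × ℝ) × ℂ => K w.1 w.2 a b) (γ s, z) (v, 0), ?_, fun z a b => ?_⟩
  · refine continuous_matrix fun a b => ?_
    have h1 := ((contDiffOn_infty_iff_fderiv_of_isOpen hO).mp (h.smooth a b)).2.continuousOn
    have h2 : Continuous fun z : ℂ =>
        fderiv ℝ (fun w : (ℝ × ℝ) × ℂ => K w.1 w.2 a b) (γ s, z) :=
      continuousOn_univ.mp (h1.comp (f := fun z : ℂ => (γ s, z)) (by fun_prop)
        fun z _ => ⟨hs, trivial⟩)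
    exact h2.clm_apply continuous_const
  · have h3 : HasFDerivAt (fun w : (ℝ × ℝ) × ℂ => K w.1 w.2 a b) _ (γ s, z) :=
      (((h.smooth a b).differentiableOn (by simp)).differentiableAt
        (hO.mem_nhds ⟨hs, trivial⟩)).hasFDerivAt
    exact h3.comp_hasDerivAt (f := fun u => (γ u, z)) s (hγ.prodMk (hasDerivAt_const s z))

theorem hasMatrixDerivAt_realValue (h : IsRealLoopFamilyOn Ω K) {γ : ℝ → ℝ × ℝ}
    {s : ℝ} (hs : γ s ∈ Ω) {α : ℝ} {A : RMat n}
    (hK : HasMatrixDerivAt (fun u => K (γ u) α) (K (γ s) α * cx A) s) :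
    HasMatrixDerivAt (fun u => realValue K α (γ u)) (realValue K α (γ s) * A) s := by
  intro a b
  have h1 := Complex.reCLM.hasFDerivAt.comp_hasDerivAt s (hK a b)
  rw [← h.cx_realValue hs, ← cx_mul] at h1
  exact h1

end IsRealLoopFamilyOn

theorem hasDerivAt_lineX (p : ℝ × ℝ) : HasDerivAt (fun u : ℝ => (u, p.2)) (1, 0) p.1 :=
  (hasDerivAt_id _).prodMk (hasDerivAt_const _ _)

theorem hasDerivAt_lineT (p : ℝ × ℝ) : HasDerivAt (fun u : ℝ => (p.1, u)) (0, 1) p.2 :=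
  (hasDerivAt_const _ _).prodMk (hasDerivAt_id _)

theorem SmoothMatOn.exists_hasMatrixDerivAt {𝕜 : Type*} [NormedField 𝕜] [NormedAlgebra ℝ 𝕜]
    {ι : Type*} {Ω : Set (ℝ × ℝ)} {f : ℝ × ℝ → Matrix ι ι 𝕜} (h : SmoothMatOn Ω f)
    (hΩ : IsOpen Ω) {γ : ℝ → ℝ × ℝ} {v : ℝ × ℝ} {s : ℝ} (hγ : HasDerivAt γ v s) (hs : γ s ∈ Ω) :
    ∃ D, HasMatrixDerivAt (fun u => f (γ u)) D s := by
  refine ⟨Matrix.of fun a b => fderiv ℝ (fun p => f p a b) (γ s) v, fun a b => ?_⟩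
  exact (((h a b).differentiableOn (by simp)).differentiableAt
    (hΩ.mem_nhds hs)).hasFDerivAt.comp_hasDerivAt s hγ

section Loops

variable {α₁ α₂ : ℝ}

/-- The two simple factors act on `Im (1 - π)` by the mutually inverse scalars `(z - α₂)/(z - α₁)`
and `(z - α₁)/(z - α₂)`. -/
theorem loop_coeff_mul {z : ℂ} (h₁ : z ≠ α₁) (h₂ : z ≠ α₂) :
    ((α₁ : ℂ) - α₂) / (z - α₁) * (((α₂ : ℂ) - α₁) / (z - α₂))
      = -(((α₁ : ℂ) - α₂) / (z - α₁) + ((α₂ : ℂ) - α₁) / (z - α₂)) := by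
  have h₁' := sub_ne_zero.mpr h₁
  have h₂' := sub_ne_zero.mpr h₂
  field_simp
  ring

theorem cx_one_sub_mul_self {P : RMat n} (hP : P * P = P) :
    cx (1 - P) * cx (1 - P) = cx (1 - P) := by
  rw [← cx_mul, mul_sub, sub_mul, sub_mul, hP]
  simp

theorem hLoop_mul_hLoop {P : RMat n} (hP : P * P = P) {z : ℂ} (h₁ : z ≠ α₁) (h₂ : z ≠ α₂) :
    hLoop α₁ α₂ P z * hLoop α₂ α₁ P z = 1 :=
  one_add_smul_mul_one_add_smul (loop_coeff_mul h₁ h₂) (cx_one_sub_mul_self hP)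

theorem hLoop_inv {P : RMat n} (hP : P * P = P) {z : ℂ} (h₁ : z ≠ α₁) (h₂ : z ≠ α₂) :
    (hLoop α₁ α₂ P z)⁻¹ = hLoop α₂ α₁ P z :=
  Matrix.inv_eq_right_inv (hLoop_mul_hLoop hP h₁ h₂)

theorem hLoop_mul_mul_hLoop {P Q : RMat n} (X : CMat n) {z : ℂ} (h₁ : z ≠ α₁) (h₂ : z ≠ α₂) :
    hLoop α₁ α₂ P z * X * hLoop α₂ α₁ Q z
      = X + (((α₁ : ℂ) - α₂) / (z - α₁)) • (cx (1 - P) * X * cx Q)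
        + (((α₂ : ℂ) - α₁) / (z - α₂)) • (cx P * X * cx (1 - Q)) := by
  have := dressing_expand (loop_coeff_mul h₁ h₂) X (cx (1 - P)) (cx (1 - Q))
  rw [← cx_one, ← cx_sub, ← cx_sub, sub_sub_cancel, sub_sub_cancel, cx_one] at this
  exact this

theorem map_conj_hLoop (P : RMat n) (z : ℂ) :
    (hLoop α₁ α₂ P (starRingEnd ℂ z)).map (starRingEnd ℂ) = hLoop α₁ α₂ P z := by
  ext a b
  simp [hLoop, Matrix.one_apply, apply_ite]

theorem continuous_ext_off {X : Type*} [TopologicalSpace X] [T2Space X] {f g : ℂ → X}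
    (hf : Continuous f) (hg : Continuous g) {a b : ℂ} (h : ∀ z, z ≠ a → z ≠ b → f z = g z) :
    f = g := by
  refine hf.ext_on (s := ({a, b} : Set ℂ)ᶜ)
    ((Set.toFinite {a, b}).countable.dense_compl ℝ) hg fun z hz => ?_
  simp only [Set.mem_compl_iff, Set.mem_insert_iff, Set.mem_singleton_iff, not_or] at hz
  exact h z hz.1 hz.2

/-- Only the germ on a punctured neighbourhood matters, and near every `z`, including `a` and `b`
themselves, this germ avoids both points. -/
theorem holoExt_congr {f g : ℂ → CMat n} {a b : ℂ}
    (h : ∀ z, z ≠ a → z ≠ b → f z = g z) : holoExt f = holoExt g := by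
  funext z
  have h1 : f =ᶠ[𝓝[≠] z] g := by
    have h2 : ∀ c : ℂ, ∀ᶠ w in 𝓝[≠] z, w ≠ c := by
      intro c
      by_cases hc : z = c
      · subst hc
        exact eventually_mem_nhdsWithin
      · exact (isOpen_ne.eventually_mem hc).filter_mono nhdsWithin_le_nhds
    filter_upwards [h2 a, h2 b] with w ha hb using h w ha hb
  unfold holoExt Filter.limUnder
  rw [Filter.map_congr h1]

theorem holoExt_of_continuous {g : ℂ → CMat n} (hg : Continuous g) : holoExt g = g := by
  funext z
  exact ((hg.tendsto z).mono_left nhdsWithin_le_nhds).limUnder_eq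

/-- Entrywise divided difference. -/
def dividedDiff (K : ℂ → CMat n) (α z : ℂ) : CMat n :=
  Matrix.of fun a b => dslope (fun w => K w a b) α z

theorem sub_smul_dividedDiff (K : ℂ → CMat n) (α z : ℂ) :
    (z - α) • dividedDiff K α z = K z - K α := by
  ext a b
  exact sub_smul_dslope (fun w => K w a b) α z

/-- The extension of `h_{α₁,α₂,P} K h_{α₁,α₂,Q}⁻¹` through its removable singularities. -/
def dressedLoop (α₁ α₂ : ℝ) (P Q : RMat n) (K : ℂ → CMat n) (z : ℂ) : CMat n :=
  K z + ((α₁ : ℂ) - α₂) • (cx (1 - P) * dividedDiff K α₁ z * cx Q)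
    + ((α₂ : ℂ) - α₁) • (cx P * dividedDiff K α₂ z * cx (1 - Q))

/-- The hypotheses say that the residues vanish; they allow `K(αᵢ)` to be subtracted before dividing
by `z - αᵢ`. -/
theorem dressedLoop_eq {P Q : RMat n} {K : ℂ → CMat n} (hl : cx (1 - P) * K α₁ * cx Q = 0)
    (hr : cx P * K α₂ * cx (1 - Q) = 0) {z : ℂ} (h₁ : z ≠ α₁) (h₂ : z ≠ α₂) :
    dressedLoop α₁ α₂ P Q K z = hLoop α₁ α₂ P z * K z * hLoop α₂ α₁ Q z := by
  have h₁' := sub_ne_zero.mpr h₁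
  have h₂' := sub_ne_zero.mpr h₂
  have e1 : cx (1 - P) * K z * cx Q
      = (z - α₁) • (cx (1 - P) * dividedDiff K α₁ z * cx Q) := by
    rw [← smul_mul_assoc, ← mul_smul_comm, sub_smul_dividedDiff, mul_sub, sub_mul, hl, sub_zero]
  have e2 : cx P * K z * cx (1 - Q)
      = (z - α₂) • (cx P * dividedDiff K α₂ z * cx (1 - Q)) := by
    rw [← smul_mul_assoc, ← mul_smul_comm, sub_smul_dividedDiff, mul_sub, sub_mul, hr, sub_zero]
  rw [hLoop_mul_mul_hLoop _ h₁ h₂, e1, e2, smul_smul, smul_smul, div_mul_cancel₀ _ h₁',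
    div_mul_cancel₀ _ h₂', dressedLoop]

end Loops

section Step

variable {Ω : Set (ℝ × ℝ)} {K : ℝ × ℝ → ℂ → CMat n} {α₁ α₂ : ℝ} {P : RMat n}

/-- The data produced by one Darboux step on an open set: `Q` is the pulled back projection and
`K'` is the extension of `h_{α₁,α₂,P} K h_{α₁,α₂,Q}⁻¹`. -/
structure IsDressing (Ω : Set (ℝ × ℝ)) (K K' : ℝ × ℝ → ℂ → CMat n) (α₁ α₂ : ℝ) (P : RMat n)
    (Q : ℝ × ℝ → RMat n) : Prop where
  pullback : ∀ p ∈ Ω, IsPullbackProj (realValue K α₁ p) (realValue K α₂ p) P (Q p)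
  smooth : SmoothMatOn Ω Q
  family : IsRealLoopFamilyOn Ω K'
  eq : ∀ p ∈ Ω, ∀ z : ℂ, z ≠ α₁ → z ≠ α₂ →
    K' p z = hLoop α₁ α₂ P z * K p z * hLoop α₂ α₁ (Q p) z
  det : ∀ p ∈ Ω, ∀ z, (K' p z).det = (K p z).det

/-- The projection on the right is conjugate to `A`, so the determinants of the two outer factors
are inverse to each other. -/
theorem det_dressing {R A : Matrix (Fin (2 * n + 1)) (Fin (2 * n + 1)) ℝ} (hA : A * A = A)
    (hR : IsUnit R.det) (X : CMat n) {z : ℂ} (h₁ : z ≠ α₁) (h₂ : z ≠ α₂) :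
    (hLoop α₁ α₂ A z * X * hLoop α₂ α₁ (R * A * R⁻¹) z).det = X.det := by
  have hRR : R * R⁻¹ = 1 := Matrix.mul_nonsing_inv _ hR
  have e1 : hLoop α₂ α₁ (R * A * R⁻¹) z = cx R * hLoop α₂ α₁ A z * cx R⁻¹ := by
    have : 1 - R * A * R⁻¹ = R * (1 - A) * R⁻¹ := by rw [mul_sub, sub_mul, mul_one, hRR]
    rw [hLoop, hLoop, this, mul_add, add_mul, mul_one, ← cx_mul, hRR, cx_one, mul_smul_comm,
      smul_mul_assoc, cx_mul, cx_mul]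
  have e2 : (cx R).det * (cx R⁻¹).det = 1 := by
    rw [← Matrix.det_mul, ← cx_mul, hRR, cx_one, Matrix.det_one]
  have e3 : (hLoop α₁ α₂ A z).det * (hLoop α₂ α₁ A z).det = 1 := by
    rw [← Matrix.det_mul, hLoop_mul_hLoop hA h₁ h₂, Matrix.det_one]
  rw [e1]
  simp only [Matrix.det_mul]
  linear_combination ((hLoop α₁ α₂ A z).det * (hLoop α₂ α₁ A z).det * X.det) * e2 + X.det * e3

theorem SmoothMatOn.dividedDiff (hK : IsRealLoopFamilyOn Ω K) (hΩ : IsOpen Ω) (α : ℂ) :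
    SmoothMatOn (Ω ×ˢ Set.univ) fun w : (ℝ × ℝ) × ℂ => dividedDiff (K w.1) α w.2 := fun a b =>
  contDiffOn_dslope hΩ (f := fun p z => K p z a b) α (hK.smooth a b) fun p hp => hK.holo p hp a b

theorem differentiable_dividedDiff {K : ℂ → CMat n} (hK : ∀ a b, Differentiable ℂ fun z => K z a b)
    (α : ℂ) (a b) : Differentiable ℂ fun z => dividedDiff K α z a b := by
  have := (Complex.differentiableOn_dslope (f := fun z => K z a b) (c := α) Filter.univ_mem).mpr
    (hK a b).differentiableOn
  exact differentiableOn_univ.mp this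

/-- Holomorphy and joint smoothness are read off from the divided differences. The determinant and
the reality condition are checked on the product formula off `α₁`, `α₂` and extended by continuity.
-/
theorem isDressing_dressedLoop (hΩ : IsOpen Ω) (hK : IsRealLoopFamilyOn Ω K) (hP : P * P = P)
    (hd : ∀ p ∈ Ω, invImage (K p α₁) (im P) ⊓ invImage (K p α₂) (ker P) = ⊥) :
    (∀ p ∈ Ω, IsCompl (invImage (K p α₁) (im P)) (invImage (K p α₂) (ker P))) ∧
    IsDressing Ω K (fun p => dressedLoop α₁ α₂ P
      (projAlong (invImage (K p α₁) (im P)) (invImage (K p α₂) (ker P))) (K p)) α₁ α₂ P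
      (fun p => projAlong (invImage (K p α₁) (im P)) (invImage (K p α₂) (ker P))) := by
  set Q : ℝ × ℝ → RMat n :=
    fun p => projAlong (invImage (K p α₁) (im P)) (invImage (K p α₂) (ker P)) with hQdef
  set B : ℝ × ℝ → RMat n := fun p => pullbackBasis (realValue K α₁ p) (realValue K α₂ p) P
  have hB : ∀ p ∈ Ω, IsUnit (B p).det := fun p hp =>
    isUnit_det_pullbackBasis hP (hK.isUnit_det_realValue hp _) (hK.isUnit_det_realValue hp _)
      (by rw [hK.cx_realValue hp, hK.cx_realValue hp]; exact hd p hp)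
  have hpull : ∀ p ∈ Ω, IsPullbackProj (realValue K α₁ p) (realValue K α₂ p) P
      (B p * P * (B p)⁻¹) := fun p hp =>
    isPullbackProj_pullbackBasis hP (hK.isUnit_det_realValue hp _)
      (hK.isUnit_det_realValue hp _) (hB p hp)
  have hcQ : ∀ p ∈ Ω, IsCompl (invImage (K p α₁) (im P)) (invImage (K p α₂) (ker P)) ∧
      Q p = B p * P * (B p)⁻¹ := by
    intro p hp
    have := (hpull p hp).projAlong_eq hP
    rwa [hK.cx_realValue hp, hK.cx_realValue hp] at this
  have hpull' : ∀ p ∈ Ω, IsPullbackProj (realValue K α₁ p) (realValue K α₂ p) P (Q p) :=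
    fun p hp => by rw [(hcQ p hp).2]; exact hpull p hp
  have hBs : SmoothMatOn Ω B :=
    (((hK.smooth_realValue α₁).inv fun p hp => (hK.isUnit_det_realValue hp α₁).ne_zero).mul
      (.const P)).add
    (((hK.smooth_realValue α₂).inv fun p hp => (hK.isUnit_det_realValue hp α₂).ne_zero).mul
      (.const (1 - P)))
  have hQs : SmoothMatOn Ω Q :=
    ((hBs.mul (.const P)).mul (hBs.inv fun p hp => (hB p hp).ne_zero)).congr
      fun p hp => (hcQ p hp).2
  have heq : ∀ p ∈ Ω, ∀ z : ℂ, z ≠ α₁ → z ≠ α₂ → dressedLoop α₁ α₂ P (Q p) (K p) z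
      = hLoop α₁ α₂ P z * K p z * hLoop α₂ α₁ (Q p) z := by
    intro p hp z h₁ h₂
    refine dressedLoop_eq ?_ ?_ h₁ h₂
    · rw [← hK.cx_realValue hp, ← cx_mul, ← cx_mul, (hpull' p hp).left, cx_zero]
    · rw [← hK.cx_realValue hp, ← cx_mul, ← cx_mul, (hpull' p hp).right, cx_zero]
  have hholo : ∀ p ∈ Ω, ∀ a b, Differentiable ℂ fun z => dressedLoop α₁ α₂ P (Q p) (K p) z a b := by
    intro p hp a b
    have hdd := fun α : ℂ => differentiable_dividedDiff (hK.holo p hp) α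
    simp only [dressedLoop, Matrix.add_apply, Matrix.smul_apply, Matrix.mul_apply, smul_eq_mul]
    refine ((hK.holo p hp a b).add ?_).add ?_ <;>
    · refine Differentiable.const_mul (Differentiable.fun_sum fun c _ =>
        Differentiable.mul_const (Differentiable.fun_sum fun d _ =>
          Differentiable.const_mul (hdd _ d c) _) _) _
  have hcont : ∀ p ∈ Ω, Continuous (dressedLoop α₁ α₂ P (Q p) (K p)) := fun p hp =>
    continuous_matrix fun a b => (hholo p hp a b).continuous
  have hdet : ∀ p ∈ Ω, ∀ z, (dressedLoop α₁ α₂ P (Q p) (K p) z).det = (K p z).det := by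
    intro p hp z
    refine congrFun (continuous_ext_off (a := α₁) (b := α₂) ((hcont p hp).matrix_det)
      ((hK.continuous hp).matrix_det) fun z h₁ h₂ => ?_) z
    rw [heq p hp z h₁ h₂, (hcQ p hp).2, det_dressing hP (hB p hp) _ h₁ h₂]
  refine ⟨fun p hp => (hcQ p hp).1, hpull', hQs, ⟨?_, hholo, ?_, ?_⟩, heq, hdet⟩
  · have hQs' : SmoothMatOn (Ω ×ˢ Set.univ) fun w : (ℝ × ℝ) × ℂ => cx (Q w.1) :=
      (hQs.comp (φ := Prod.fst) contDiff_fst fun w hw => hw.1).cx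
    have hQs'' : SmoothMatOn (Ω ×ˢ Set.univ) fun w : (ℝ × ℝ) × ℂ => cx (1 - Q w.1) :=
      ((SmoothMatOn.const 1).sub (hQs.comp (φ := Prod.fst) contDiff_fst fun w hw => hw.1)).cx
    exact (hK.smooth.add
      ((((SmoothMatOn.const (cx (1 - P))).mul (.dividedDiff hK hΩ α₁)).mul hQs').const_smul _)).add
      ((((SmoothMatOn.const (cx P)).mul (.dividedDiff hK hΩ α₂)).mul hQs'').const_smul _)
  · exact fun p hp z => by rw [hdet p hp]; exact hK.det p hp z
  · intro p hp z
    refine congrFun (continuous_ext_off (a := α₁) (b := α₂) (f := fun z =>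
      (dressedLoop α₁ α₂ P (Q p) (K p) (starRingEnd ℂ z)).map (starRingEnd ℂ)) ?_ (hcont p hp)
      fun z h₁ h₂ => ?_) z
    · exact ((hcont p hp).comp Complex.continuous_conj).matrix_map Complex.continuous_conj
    · have hc : ∀ {α : ℝ}, z ≠ α → starRingEnd ℂ z ≠ α := fun {α} h h' => h (by
        rw [← Complex.conj_conj z, h', Complex.conj_ofReal])
      rw [heq p hp _ (hc h₁) (hc h₂), heq p hp z h₁ h₂, Matrix.map_mul, Matrix.map_mul,
        map_conj_hLoop, map_conj_hLoop, hK.real p hp]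

namespace IsDressing

variable {K' : ℝ × ℝ → ℂ → CMat n} {Q : ℝ × ℝ → RMat n}

/-- Serves both the `x` and the `t` direction. The new connection `B` is prescribed by a formula
only off `α₁`, `α₂`, so a polynomial candidate can be inserted and continuity settles the remaining
two values. -/
theorem hasMatrixDerivAt (h : IsDressing Ω K K' α₁ α₂ P Q) (hΩ : IsOpen Ω)
    (hK : IsRealLoopFamilyOn Ω K) {γ : ℝ → ℝ × ℝ} {v : ℝ × ℝ} {s : ℝ} (hγ : HasDerivAt γ v s)
    (hs : γ s ∈ Ω) {A : ℂ → CMat n} {A₁ A₂ : RMat n} (hA₁ : A α₁ = cx A₁) (hA₂ : A α₂ = cx A₂)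
    (hA : ∀ z, HasMatrixDerivAt (fun u => K (γ u) z) (K (γ s) z * A z) s) :
    HasMatrixDerivAt (fun u => Q (γ u))
      (Q (γ s) * A₂ * (1 - Q (γ s)) - (1 - Q (γ s)) * A₁ * Q (γ s)) s ∧
    ∀ B : ℂ → CMat n, Continuous B →
      (∀ z : ℂ, z ≠ α₁ → z ≠ α₂ → B z = A z
        + (((α₁ : ℂ) - α₂) / (z - α₁)) • (cx (1 - Q (γ s)) * (A z - cx A₁) * cx (Q (γ s)))
        + (((α₂ : ℂ) - α₁) / (z - α₂)) • (cx (Q (γ s)) * (A z - cx A₂) * cx (1 - Q (γ s)))) →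
      ∀ z, HasMatrixDerivAt (fun u => K' (γ u) z) (K' (γ s) z * B z) s := by
  have hev : ∀ᶠ u in 𝓝 s, γ u ∈ Ω := hγ.continuousAt.eventually (hΩ.mem_nhds hs)
  obtain ⟨Q', hQ'⟩ := h.smooth.exists_hasMatrixDerivAt hΩ hγ hs
  have hode := IsPullbackProj.hasMatrixDerivAt (hev.mono fun u hu => h.pullback _ hu)
    (hK.hasMatrixDerivAt_realValue hs (hA₁ ▸ hA α₁))
    (hK.hasMatrixDerivAt_realValue hs (hA₂ ▸ hA α₂)) hQ'
  have hode' : cx Q' = cx (Q (γ s)) * cx A₂ * (1 - cx (Q (γ s)))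
      - (1 - cx (Q (γ s))) * cx A₁ * cx (Q (γ s)) := by
    rw [hode]
    simp only [cx_sub, cx_mul, cx_one]
  have hidem : cx (Q (γ s)) * cx (Q (γ s)) = cx (Q (γ s)) := by
    rw [← cx_mul, (h.pullback _ hs).idem]
  refine ⟨hode ▸ hQ', fun B hBc hB => ?_⟩
  obtain ⟨D, hDc, hD⟩ := h.family.exists_hasMatrixDerivAt hΩ hγ hs
  suffices hfin : D = fun z => K' (γ s) z * B z by
    intro z
    have := hD z
    rwa [hfin] at this
  refine continuous_ext_off (a := α₁) (b := α₂) hDc ((h.family.continuous hs).matrix_mul hBc)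
    fun z h₁ h₂ => ?_
  have hloop : HasMatrixDerivAt (fun u => hLoop α₂ α₁ (Q (γ u)) z)
      ((((α₂ : ℂ) - α₁) / (z - α₂)) • cx (0 - Q')) s := by
    have := (HasMatrixDerivAt.const (1 : CMat n)).add
      ((((HasMatrixDerivAt.const (1 : RMat n)).sub hQ').cx).const_smul
        (((α₂ : ℂ) - α₁) / (z - α₂)))
    rw [zero_add] at this
    exact this
  have h3 := (((HasMatrixDerivAt.const (hLoop α₁ α₂ P z)).mul (hA z)).mul
    hloop).congr_of_eventuallyEq (hev.mono fun u hu => h.eq _ hu z h₁ h₂)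
  rw [(hD z).unique h3, h.eq _ hs z h₁ h₂, hB z h₁ h₂]
  have huv := loop_coeff_mul (α₁ := α₁) (α₂ := α₂) h₁ h₂
  have hg := dressing_gauge huv (X := A z) hidem hode'
  have hdd := dressing_deriv huv hidem hode'
  have hii := hLoop_mul_hLoop (α₁ := α₂) (α₂ := α₁) (h.pullback _ hs).idem h₂ h₁
  rw [cx_sub 1, cx_one, ← hg, zero_mul, zero_add, cx_sub 0, cx_zero, zero_sub]
  simp only [hLoop, cx_sub, cx_one] at hii ⊢
  set u := ((α₁ : ℂ) - α₂) / (z - α₁)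
  set w := ((α₂ : ℂ) - α₁) / (z - α₂)
  set e := 1 - cx (Q (γ s))
  -- With `H' = 1 + w e` the inverse factor, this reads `H' B = A H' + (H')_s`, where `B` is the new
  -- connection.
  have e1 : (1 + w • e) * ((1 + u • e) * A z * (1 + w • e) + u • (cx Q' * (1 + w • e)))
      = A z * (1 + w • e) - w • cx Q' := by
    rw [mul_add, mul_smul_comm, hdd, ← mul_assoc, ← mul_assoc, hii, one_mul, ← sub_eq_add_neg]
  rw [mul_assoc ((1 + u • (1 - cx P)) * K (γ s) z) (1 + w • e), e1, mul_sub, smul_neg, mul_neg,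
    ← sub_eq_add_neg]
  simp only [mul_assoc]

end IsDressing

end Step

end AnalyticDressing

/-! ### Formal Laurent series in `λ⁻¹` with matrix coefficients. -/

section LoopSeries

variable {n : ℕ}

section LaurentLoops

theorem loop_smul_mul (x : LaurentSeries ℝ) (X Y : LoopMat n) : x • X * Y = x • (X * Y) :=
  Matrix.smul_mul x X Y

theorem loop_mul_smul (x : LaurentSeries ℝ) (X Y : LoopMat n) : X * x • Y = x • (X * Y) :=
  Matrix.mul_smul X x Y

theorem loop_smul_smul (x y : LaurentSeries ℝ) (X : LoopMat n) : x • y • X = (x * y) • X :=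
  smul_smul x y X

theorem loop_sub_smul (x y : LaurentSeries ℝ) (X : LoopMat n) : (x - y) • X = x • X - y • X :=
  sub_smul x y X

theorem loop_one_smul (X : LoopMat n) : (1 : LaurentSeries ℝ) • X = X := one_smul _ X

theorem constLoop_eq (A : RMat n) : constLoop A = (HahnSeries.C : ℝ →+* LaurentSeries ℝ).mapMatrix A :=
  rfl

@[simp] theorem constLoop_one : constLoop (1 : RMat n) = 1 := by simp only [constLoop_eq, map_one]

theorem constLoop_mul (A B : RMat n) : constLoop (A * B) = constLoop A * constLoop B := by
  simp only [constLoop_eq, map_mul]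

theorem constLoop_add (A B : RMat n) : constLoop (A + B) = constLoop A + constLoop B := by
  simp only [constLoop_eq, map_add]

theorem constLoop_sub (A B : RMat n) : constLoop (A - B) = constLoop A - constLoop B := by
  simp only [constLoop_eq, map_sub]

theorem constLoop_neg (A : RMat n) : constLoop (-A) = -constLoop A := by
  simp only [constLoop_eq, map_neg]

theorem constLoop_smul (r : ℝ) (A : RMat n) :
    constLoop (r • A) = (HahnSeries.C r : LaurentSeries ℝ) • constLoop A := by
  ext a b : 2
  simp [constLoop]

theorem constLoop_transpose (A : RMat n) : constLoop Aᵀ = (constLoop A)ᵀ := rfl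

@[simp] theorem lcoeff_zero (i : ℤ) : lcoeff i (0 : LoopMat n) = 0 := by ext; simp [lcoeff]

theorem lcoeff_add (i : ℤ) (X Y : LoopMat n) : lcoeff i (X + Y) = lcoeff i X + lcoeff i Y := by
  ext; simp [lcoeff]

theorem lcoeff_sub (i : ℤ) (X Y : LoopMat n) : lcoeff i (X - Y) = lcoeff i X - lcoeff i Y := by
  ext; simp [lcoeff]

theorem lcoeff_C_smul (i : ℤ) (r : ℝ) (X : LoopMat n) :
    lcoeff i ((HahnSeries.C r : LaurentSeries ℝ) • X) = r • lcoeff i X := by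
  ext; simp [lcoeff]

theorem lcoeff_lam_smul (i : ℤ) (X : LoopMat n) : lcoeff i (lam • X) = lcoeff (i - 1) X := by
  ext a b
  have := HahnSeries.coeff_single_mul_add (r := (1 : ℝ)) (x := X a b) (a := -i + 1) (b := -1)
  simp only [lcoeff, lam, Matrix.map_apply, Matrix.smul_apply, smul_eq_mul]
  rw [show -(i - 1) = -i + 1 by ring, ← one_mul ((X a b).coeff (-i + 1)), ← this]
  congr 1
  ring

theorem lcoeff_constLoop (i : ℤ) (A : RMat n) :
    lcoeff i (constLoop A) = if i = 0 then A else 0 := by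
  ext a b
  by_cases h : i = 0
  · simp [lcoeff, constLoop, h, HahnSeries.C_apply]
  · simp [lcoeff, constLoop, h, HahnSeries.C_apply]

/-- `X` contains only powers `λ^i` with `i ≤ d`. -/
def LoopDegLE (d : ℤ) (X : LoopMat n) : Prop := ∀ i, d < i → lcoeff i X = 0

/-- The index set depends only on bounds for the supports and not on the series, so coefficients of
products of varying series can be differentiated term by term. -/
theorem laurent_coeff_mul {x y : LaurentSeries ℝ} {m m' : ℤ} (hx : ∀ k < m, x.coeff k = 0)
    (hy : ∀ k < m', y.coeff k = 0) (k : ℤ) :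
    (x * y).coeff k = ∑ i ∈ Finset.Icc m (k - m'), x.coeff i * y.coeff (k - i) := by
  rw [HahnSeries.coeff_mul]
  refine Finset.sum_of_injOn (e := Prod.fst) ?_ ?_ ?_ ?_
  · rintro ⟨a, b⟩ h ⟨c, d⟩ h' e
    simp only [Finset.mem_coe, Finset.mem_antidiagonal] at h h' e
    ext
    · exact e
    · change b = d
      have h1 : a + b = k := h.2.2
      have h2 : c + d = k := h'.2.2
      change a = c at e
      omega
  · rintro ⟨a, b⟩ h
    simp only [Finset.mem_coe, Finset.mem_antidiagonal, HahnSeries.mem_support] at h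
    have h1 : ¬ a < m := fun h' => h.1 (hx a h')
    have h2 : ¬ b < m' := fun h' => h.2.1 (hy b h')
    have h3 := h.2.2
    simp only [Finset.mem_coe, Finset.mem_Icc]
    omega
  · intro i _ hi
    by_contra h0
    refine hi ⟨(i, k - i), ?_, rfl⟩
    simp only [Finset.mem_coe, Finset.mem_antidiagonal, HahnSeries.mem_support]
    exact ⟨left_ne_zero_of_mul h0, right_ne_zero_of_mul h0, by ring⟩
  · rintro ⟨a, b⟩ h
    simp only [Finset.mem_antidiagonal] at h
    have : b = k - a := by omega
    rw [this]

theorem lcoeff_mul {X Y : LoopMat n} {d e : ℤ} (hX : LoopDegLE d X) (hY : LoopDegLE e Y) (k : ℤ) :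
    lcoeff k (X * Y) = ∑ i ∈ Finset.Icc (k - e) d, lcoeff i X * lcoeff (k - i) Y := by
  have hX' : ∀ a b, ∀ i < -d, (X a b).coeff i = 0 := fun a b i hi => by
    simpa [lcoeff] using congrFun (congrFun (hX (-i) (by omega)) a) b
  have hY' : ∀ a b, ∀ i < -e, (Y a b).coeff i = 0 := fun a b i hi => by
    simpa [lcoeff] using congrFun (congrFun (hY (-i) (by omega)) a) b
  ext a b
  rw [Matrix.sum_apply]
  simp only [lcoeff, Matrix.map_apply, Matrix.mul_apply, HahnSeries.coeff_sum]
  rw [Finset.sum_comm]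
  refine Finset.sum_congr rfl fun c _ => ?_
  rw [laurent_coeff_mul (hX' a c) (hY' c b)]
  refine Finset.sum_nbij' (fun i => -i) (fun i => -i) ?_ ?_ ?_ ?_ ?_
  · intro i hi
    simp only [Finset.mem_Icc] at hi ⊢
    omega
  · intro i hi
    simp only [Finset.mem_Icc] at hi ⊢
    omega
  · intro i _
    exact neg_neg i
  · intro i _
    exact neg_neg i
  · intro i _
    rw [neg_neg, show -(k - -i) = -k - i by ring]

namespace LoopDegLE

variable {X Y : LoopMat n} {d e : ℤ}

theorem mono (h : LoopDegLE d X) (hde : d ≤ e) : LoopDegLE e X := fun i hi => h i (hde.trans_lt hi)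

theorem add (hX : LoopDegLE d X) (hY : LoopDegLE d Y) : LoopDegLE d (X + Y) := fun i hi => by
  rw [lcoeff_add, hX i hi, hY i hi, add_zero]

theorem mul (hX : LoopDegLE d X) (hY : LoopDegLE e Y) : LoopDegLE (d + e) (X * Y) := fun i hi => by
  rw [lcoeff_mul hX hY, Finset.Icc_eq_empty (by omega), Finset.sum_empty]

theorem constLoop (A : RMat n) : LoopDegLE 0 (constLoop A) := fun i hi => by
  rw [lcoeff_constLoop, if_neg (by omega)]

theorem pow (hX : LoopDegLE 1 X) (m : ℕ) : LoopDegLE m (X ^ m) := by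
  induction m with
  | zero => simpa using LoopDegLE.constLoop (1 : RMat n)
  | succ m ih => rw [pow_succ, Nat.cast_succ]; exact ih.mul hX

theorem C_smul (r : ℝ) (hX : LoopDegLE d X) :
    LoopDegLE d ((HahnSeries.C r : LaurentSeries ℝ) • X) := fun i hi => by
  rw [lcoeff_C_smul, hX i hi, smul_zero]

end LoopDegLE

theorem lcoeff_constLoop_mul (i : ℤ) (A : RMat n) (X : LoopMat n) :
    lcoeff i (constLoop A * X) = A * lcoeff i X := by
  ext a b
  simp [lcoeff, constLoop, Matrix.mul_apply, HahnSeries.coeff_sum]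

theorem lcoeff_mul_constLoop (i : ℤ) (A : RMat n) (X : LoopMat n) :
    lcoeff i (X * constLoop A) = lcoeff i X * A := by
  ext a b
  simp [lcoeff, constLoop, Matrix.mul_apply, HahnSeries.coeff_sum, mul_comm]

/-- `1 / (λ - α)`, expanded in powers of `λ⁻¹`. -/
def resolvent (α : ℝ) : LaurentSeries ℝ :=
  HahnSeries.single (1 : ℤ) (1 : ℝ) * HahnSeries.ofPowerSeries ℤ ℝ (PowerSeries.mk fun k => α ^ k)

theorem sub_mul_resolvent (α : ℝ) : (lam - HahnSeries.C α) * resolvent α = 1 := by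
  have h1 : lam * HahnSeries.single (1 : ℤ) (1 : ℝ) = 1 := by
    rw [lam, HahnSeries.single_mul_single]
    simp
  have h2 : (1 - PowerSeries.C α * PowerSeries.X) * PowerSeries.mk (fun k => α ^ k) = 1 := by
    ext k
    rw [sub_mul, one_mul, map_sub, mul_assoc, PowerSeries.coeff_C_mul]
    cases k with
    | zero => simp
    | succ k => simp [PowerSeries.coeff_succ_X_mul, pow_succ, mul_comm, PowerSeries.coeff_one]
  have h3 := congrArg (HahnSeries.ofPowerSeries ℤ ℝ) h2
  rw [map_mul, map_sub, map_mul, map_one, HahnSeries.ofPowerSeries_C,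
    HahnSeries.ofPowerSeries_X] at h3
  rw [resolvent]
  linear_combination (HahnSeries.ofPowerSeries ℤ ℝ (PowerSeries.mk fun k => α ^ k)) * h1 + h3

theorem resolvent_coeff_eq_zero (α : ℝ) {k : ℤ} (hk : k < 1) : (resolvent α).coeff k = 0 := by
  have := HahnSeries.coeff_single_mul_add (r := (1 : ℝ))
    (x := HahnSeries.ofPowerSeries ℤ ℝ (PowerSeries.mk fun k => α ^ k)) (a := k - 1) (b := 1)
  rw [sub_add_cancel, one_mul] at this
  rw [resolvent, this, HahnSeries.ofPowerSeries_apply]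
  refine HahnSeries.embDomain_of_notMem_range ?_
  rintro ⟨m, hm⟩
  simp at hm
  omega

theorem loopDegLE_resolvent_smul {X : LoopMat n} {d : ℤ} (hX : LoopDegLE d X) (α : ℝ) :
    LoopDegLE (d - 1) (resolvent α • X) := by
  have h1 : LoopDegLE (-1) (resolvent α • (1 : LoopMat n)) := by
    intro i hi
    ext a b
    by_cases hab : a = b
    · subst hab
      simpa [lcoeff] using resolvent_coeff_eq_zero α (k := -i) (by omega)
    · simp [lcoeff, Matrix.one_apply_ne hab]
  have h2 := h1.mul hX
  rw [loop_smul_mul, one_mul] at h2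
  exact h2.mono (by omega)

theorem lcoeff_resolvent_smul (X : LoopMat n) (α : ℝ) (i : ℤ) :
    lcoeff (i - 1) (resolvent α • X) - α • lcoeff i (resolvent α • X) = lcoeff i X := by
  rw [← lcoeff_lam_smul, ← lcoeff_C_smul, ← lcoeff_sub, ← loop_sub_smul, loop_smul_smul,
    sub_mul_resolvent, loop_one_smul]

end LaurentLoops

section PolynomialPart

/-- The value at `z` of the polynomial part of `X`, of degree less than `N`. -/
def polyPart (N : ℕ) (X : LoopMat n) (z : ℂ) : CMat n :=
  ∑ i ∈ Finset.range N, z ^ i • cx (lcoeff (i : ℤ) X)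

theorem plusPart_eq (j : ℕ) (T : LoopMat n) (z : ℂ) :
    plusPart j T z = polyPart (2 * j) (T ^ (2 * j - 1)) z := rfl

theorem continuous_polyPart (N : ℕ) (X : LoopMat n) : Continuous (polyPart N X) := by
  unfold polyPart
  fun_prop

theorem polyPart_add (N : ℕ) (X Y : LoopMat n) (z : ℂ) :
    polyPart N (X + Y) z = polyPart N X z + polyPart N Y z := by
  simp only [polyPart, lcoeff_add, cx_add, smul_add, Finset.sum_add_distrib]

theorem polyPart_C_smul (N : ℕ) (r : ℝ) (X : LoopMat n) (z : ℂ) :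
    polyPart N ((HahnSeries.C r : LaurentSeries ℝ) • X) z = (r : ℂ) • polyPart N X z := by
  simp only [polyPart, lcoeff_C_smul, cx_smul, Finset.smul_sum]
  exact Finset.sum_congr rfl fun i _ => smul_comm _ _ _

theorem polyPart_constLoop_mul_mul (N : ℕ) (A B : RMat n) (X : LoopMat n) (z : ℂ) :
    polyPart N (constLoop A * X * constLoop B) z = cx A * polyPart N X z * cx B := by
  simp only [polyPart, lcoeff_mul_constLoop, lcoeff_constLoop_mul, cx_mul, Finset.mul_sum,
    Finset.sum_mul, mul_smul_comm, smul_mul_assoc]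

theorem exists_polyPart_ofReal (N : ℕ) (X : LoopMat n) (α : ℝ) :
    ∃ A : RMat n, polyPart N X α = cx A := by
  refine ⟨∑ i ∈ Finset.range N, α ^ i • lcoeff (i : ℤ) X, ?_⟩
  rw [polyPart, cx_eq, map_sum]
  refine Finset.sum_congr rfl fun i _ => ?_
  rw [← cx_eq, cx_smul, Complex.ofReal_pow]

/-- Bridge from formal series to functions of `z`: the polynomial part of `X / (λ - α)` is the
divided difference at `α` of the polynomial part of `X`. -/
theorem sub_smul_polyPart_resolvent {N : ℕ} {X : LoopMat n} (hX : LoopDegLE (N - 1) X) (α : ℝ)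
    (z : ℂ) : (z - α) • polyPart N (resolvent α • X) z = polyPart N X z - polyPart N X α := by
  set Y := resolvent α • X
  -- `Y` has degree at most `N - 2`, so the boundary term of the telescoping sum below vanishes at
  -- `M = N`.
  have hY : lcoeff ((N : ℤ) - 1) Y = 0 := loopDegLE_resolvent_smul hX α _ (by omega)
  have key : ∀ z : ℂ, (z - α) • polyPart N Y z = polyPart N X z - cx (lcoeff (-1) Y) := by
    intro z
    have h1 : ∀ M : ℕ, (z - α) • polyPart M Y z + cx (lcoeff (-1) Y)
        = polyPart M X z + z ^ M • cx (lcoeff ((M : ℤ) - 1) Y) := by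
      intro M
      induction M with
      | zero => simp [polyPart]
      | succ M ih =>
        have h2 := lcoeff_resolvent_smul X α M
        rw [← sub_add_cancel (lcoeff ((M : ℤ) - 1) Y) (α • lcoeff (M : ℤ) Y), h2, cx_add,
          cx_smul] at ih
        simp only [polyPart, Finset.sum_range_succ, smul_add] at ih ⊢
        rw [add_right_comm, ih]
        simp only [Nat.cast_succ, add_sub_cancel_right, pow_succ]
        module
    have h3 := h1 N
    rw [hY, cx_zero, smul_zero, add_zero] at h3
    rw [← h3, add_sub_cancel_right]
  -- Setting `z = α` identifies the coefficient of `λ⁻¹` in `Y` with the value of the polynomial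
  -- part of `X` at `α`.
  have h4 := key α
  rw [sub_self, zero_smul, eq_comm, sub_eq_zero] at h4
  rw [key, h4]

end PolynomialPart

section LoopCalculus

/-- Coefficientwise derivative of a curve of loops. -/
def HasLoopDerivAt (X : ℝ → LoopMat n) (X' : LoopMat n) (s : ℝ) : Prop :=
  (∃ d, ∀ᶠ u in 𝓝 s, LoopDegLE d (X u)) ∧
    ∀ i, HasMatrixDerivAt (fun u => lcoeff i (X u)) (lcoeff i X') s

/-- Coefficientwise smoothness of a loop-valued function. -/
def SmoothLoopOn (Ω : Set (ℝ × ℝ)) (X : ℝ × ℝ → LoopMat n) : Prop :=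
  (∃ d, ∀ p ∈ Ω, LoopDegLE d (X p)) ∧ ∀ i, SmoothMatOn Ω fun p => lcoeff i (X p)

theorem HasMatrixDerivAt.sum {κ : Type*} {f : κ → ℝ → RMat n} {f' : κ → RMat n} {s : ℝ}
    (t : Finset κ) (h : ∀ i ∈ t, HasMatrixDerivAt (f i) (f' i) s) :
    HasMatrixDerivAt (fun u => ∑ i ∈ t, f i u) (∑ i ∈ t, f' i) s := fun a b => by
  simp only [Matrix.sum_apply]
  exact HasDerivAt.fun_sum fun i hi => h i hi a b

namespace HasLoopDerivAt

variable {X Y : ℝ → LoopMat n} {X' Y' : LoopMat n} {s : ℝ}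

theorem degLE (hX : HasLoopDerivAt X X' s) {d : ℤ} (h : ∀ᶠ u in 𝓝 s, LoopDegLE d (X u)) :
    LoopDegLE d X' := fun i hi =>
  (hX.2 i).unique ((HasMatrixDerivAt.const 0).congr_of_eventuallyEq
    (h.mono fun _ hu => hu i hi))

theorem add (hX : HasLoopDerivAt X X' s) (hY : HasLoopDerivAt Y Y' s) :
    HasLoopDerivAt (fun u => X u + Y u) (X' + Y') s := by
  obtain ⟨⟨d, hd⟩, hX2⟩ := hX
  obtain ⟨⟨e, he⟩, hY2⟩ := hY
  refine ⟨⟨max d e, ?_⟩, fun i => ?_⟩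
  · filter_upwards [hd, he] with u h1 h2
    exact (h1.mono (le_max_left _ _)).add (h2.mono (le_max_right _ _))
  · simp only [lcoeff_add]
    exact (hX2 i).add (hY2 i)

theorem mul (hX : HasLoopDerivAt X X' s) (hY : HasLoopDerivAt Y Y' s) :
    HasLoopDerivAt (fun u => X u * Y u) (X' * Y s + X s * Y') s := by
  obtain ⟨d, hd⟩ := hX.1
  obtain ⟨e, he⟩ := hY.1
  have hX' := hX.degLE hd
  have hY' := hY.degLE he
  refine ⟨⟨d + e, ?_⟩, fun i => ?_⟩
  · filter_upwards [hd, he] with u h1 h2 using h1.mul h2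
  · rw [lcoeff_add, lcoeff_mul hX' he.self_of_nhds, lcoeff_mul hd.self_of_nhds hY',
      ← Finset.sum_add_distrib]
    refine (HasMatrixDerivAt.sum _ fun k _ => (hX.2 k).mul (hY.2 (i - k))).congr_of_eventuallyEq ?_
    filter_upwards [hd, he] with u h1 h2 using lcoeff_mul h1 h2 i

theorem const {d : ℤ} {X : LoopMat n} (h : LoopDegLE d X) : HasLoopDerivAt (fun _ => X) 0 s :=
  ⟨⟨d, .of_forall fun _ => h⟩, fun i => by rw [lcoeff_zero]; exact .const _⟩

theorem constLoop {A : ℝ → RMat n} {A' : RMat n} (h : HasMatrixDerivAt A A' s) :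
    HasLoopDerivAt (fun u => BnDarboux.constLoop (A u)) (BnDarboux.constLoop A') s := by
  refine ⟨⟨0, .of_forall fun _ => .constLoop _⟩, fun i => ?_⟩
  simp only [lcoeff_constLoop]
  split_ifs
  · exact h
  · exact .const _

end HasLoopDerivAt

namespace SmoothLoopOn

variable {Ω : Set (ℝ × ℝ)} {X Y : ℝ × ℝ → LoopMat n}

theorem add (hX : SmoothLoopOn Ω X) (hY : SmoothLoopOn Ω Y) :
    SmoothLoopOn Ω fun p => X p + Y p := by
  obtain ⟨⟨d, hd⟩, hX2⟩ := hX
  obtain ⟨⟨e, he⟩, hY2⟩ := hY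
  refine ⟨⟨max d e, fun p hp => ?_⟩, fun i => ?_⟩
  · exact ((hd p hp).mono (le_max_left _ _)).add ((he p hp).mono (le_max_right _ _))
  · simp only [lcoeff_add]
    exact (hX2 i).add (hY2 i)

theorem mul (hX : SmoothLoopOn Ω X) (hY : SmoothLoopOn Ω Y) :
    SmoothLoopOn Ω fun p => X p * Y p := by
  obtain ⟨⟨d, hd⟩, hX2⟩ := hX
  obtain ⟨⟨e, he⟩, hY2⟩ := hY
  refine ⟨⟨d + e, fun p hp => (hd p hp).mul (he p hp)⟩, fun i => ?_⟩
  refine SmoothMatOn.congr (f := fun p => ∑ k ∈ Finset.Icc (i - e) d,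
    lcoeff k (X p) * lcoeff (i - k) (Y p)) (fun a b => ?_)
    fun p hp => lcoeff_mul (hd p hp) (he p hp) i
  simp only [Matrix.sum_apply]
  exact ContDiffOn.sum fun k _ => ((hX2 k).mul (hY2 (i - k))) a b

theorem const {d : ℤ} {X : LoopMat n} (h : LoopDegLE d X) : SmoothLoopOn Ω fun _ => X :=
  ⟨⟨d, fun _ _ => h⟩, fun _ => .const _⟩

theorem constLoop {A : ℝ × ℝ → RMat n} (h : SmoothMatOn Ω A) :
    SmoothLoopOn Ω fun p => BnDarboux.constLoop (A p) := by
  refine ⟨⟨0, fun _ _ => .constLoop _⟩, fun i => ?_⟩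
  simp only [lcoeff_constLoop]
  split_ifs
  · exact h
  · exact .const _

theorem pow (hX : SmoothLoopOn Ω X) (m : ℕ) : SmoothLoopOn Ω fun p => X p ^ m := by
  induction m with
  | zero =>
    simp only [pow_zero]
    rw [← constLoop_one]
    exact const (.constLoop 1)
  | succ m ih =>
    simp only [pow_succ]
    exact ih.mul hX

end SmoothLoopOn

end LoopCalculus

end LoopSeries

/-! ### The Darboux step for the formal series, and both halves combined. -/

section FormalDressing

/-- The product rule for `H T H'` when `H_x = -u D`, `(H')_x = -v D` and `T_x = [T, L]`: the result
is the Lax equation for the gauge transform of `L`. -/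
theorem dressing_lax {R A : Type*} [CommRing R] [Ring A] [Algebra R A] {u v : R}
    {H H' D T L : A} (hH : H' * H = 1) (hD : u • (H' * (D * H')) = -(v • D)) :
    -(u • D) * T * H' + H * (T * L - L * T) * H' + H * T * -(v • D)
      = H * T * H' * (H * L * H' + u • (D * H')) - (H * L * H' + u • (D * H')) * (H * T * H') := by
  have e1 : H * T * H' * (H * L * H') = H * T * L * H' := by
    rw [show H * T * H' * (H * L * H') = H * T * (H' * H) * L * H' by noncomm_ring, hH, mul_one]
  have e2 : H * L * H' * (H * T * H') = H * L * T * H' := by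
    rw [show H * L * H' * (H * T * H') = H * L * (H' * H) * T * H' by noncomm_ring, hH, mul_one]
  have e3 : D * H' * (H * T * H') = D * T * H' := by
    rw [show D * H' * (H * T * H') = D * (H' * H) * T * H' by noncomm_ring, hH, mul_one]
  have e4 : H * T * H' * u • (D * H') = H * T * -(v • D) := by
    rw [← hD, mul_smul_comm, mul_smul_comm, mul_assoc (H * T)]
  rw [mul_add, add_mul, e1, e2, e4, smul_mul_assoc, e3, mul_sub, sub_mul, neg_mul, neg_mul,
    smul_mul_assoc, smul_mul_assoc, ← mul_assoc H T L, ← mul_assoc H L T]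
  abel

variable {n : ℕ} {α₁ α₂ : ℝ}

section Series

/-- The scalar `(α₁ - α₂) / (λ - α₁)`, expanded in powers of `λ⁻¹`. -/
def loopScalar (α₁ α₂ : ℝ) : LaurentSeries ℝ := HahnSeries.C (α₁ - α₂) * resolvent α₁

/-- `h_{α₁,α₂,Q}` as a formal series. -/
def hSeries (α₁ α₂ : ℝ) (Q : RMat n) : LoopMat n := 1 + loopScalar α₁ α₂ • constLoop (1 - Q)

theorem loopScalar_mul (α₁ α₂ : ℝ) :
    loopScalar α₁ α₂ * loopScalar α₂ α₁ = -(loopScalar α₁ α₂ + loopScalar α₂ α₁) := by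
  have h₁ := sub_mul_resolvent α₁
  have h₂ := sub_mul_resolvent α₂
  simp only [loopScalar, map_sub]
  linear_combination (HahnSeries.C α₁ - HahnSeries.C α₂) * resolvent α₂ * h₁
    - (HahnSeries.C α₁ - HahnSeries.C α₂) * resolvent α₁ * h₂

theorem loopScalar_smul (X : LoopMat n) :
    loopScalar α₁ α₂ • X = (HahnSeries.C (α₁ - α₂) : LaurentSeries ℝ) • resolvent α₁ • X := by
  rw [loop_smul_smul, loopScalar]

theorem constLoop_idem {Q : RMat n} (hQ : Q * Q = Q) :
    constLoop Q * constLoop Q = constLoop Q := by rw [← constLoop_mul, hQ]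

theorem constLoop_one_sub (Q : RMat n) : constLoop (1 - Q) = 1 - constLoop Q := by
  rw [constLoop_sub, constLoop_one]

theorem hSeries_eq (Q : RMat n) : hSeries α₁ α₂ Q = 1 + loopScalar α₁ α₂ • (1 - constLoop Q) := by
  rw [hSeries, constLoop_one_sub]

theorem hSeries_mul_hSeries {Q : RMat n} (hQ : Q * Q = Q) :
    hSeries α₁ α₂ Q * hSeries α₂ α₁ Q = 1 := by
  have hQ' : (1 - Q) * (1 - Q) = 1 - Q := by
    rw [sub_mul, mul_sub, mul_sub, hQ]
    simp
  exact one_add_smul_mul_one_add_smul (loopScalar_mul α₁ α₂) (constLoop_idem hQ')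

theorem loopDegLE_loopScalar_smul {X : LoopMat n} {d : ℤ} (hX : LoopDegLE d X) :
    LoopDegLE (d - 1) (loopScalar α₁ α₂ • X) := by
  rw [loopScalar_smul]
  exact (loopDegLE_resolvent_smul hX α₁).C_smul _

/-- `h_{α₁,α₂,Q} T h_{α₁,α₂,Q}⁻¹` as a formal series. -/
def dressSeries (α₁ α₂ : ℝ) (Q : RMat n) (T : LoopMat n) : LoopMat n :=
  hSeries α₁ α₂ Q * T * hSeries α₂ α₁ Q

theorem dressSeries_eq (Q : RMat n) (T : LoopMat n) :
    dressSeries α₁ α₂ Q T = T + loopScalar α₁ α₂ • (constLoop (1 - Q) * T * constLoop Q)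
      + loopScalar α₂ α₁ • (constLoop Q * T * constLoop (1 - Q)) := by
  have := dressing_expand (loopScalar_mul α₁ α₂) T (constLoop (1 - Q)) (constLoop (1 - Q))
  rw [← constLoop_one, ← constLoop_sub, sub_sub_cancel, constLoop_one] at this
  exact this

theorem dressSeries_pow {Q : RMat n} (hQ : Q * Q = Q) (T : LoopMat n) (m : ℕ) :
    dressSeries α₁ α₂ Q T ^ m = dressSeries α₁ α₂ Q (T ^ m) := by
  induction m with
  | zero => rw [pow_zero, pow_zero, dressSeries, mul_one, hSeries_mul_hSeries hQ]
  | succ m ih =>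
    rw [pow_succ, ih, dressSeries, dressSeries, dressSeries, pow_succ]
    calc _ = hSeries α₁ α₂ Q * T ^ m * (hSeries α₂ α₁ Q * hSeries α₁ α₂ Q) * T
          * hSeries α₂ α₁ Q := by noncomm_ring
      _ = _ := by rw [hSeries_mul_hSeries hQ, mul_one, ← mul_assoc]

theorem loopDegLE_conj {X : LoopMat n} {d : ℤ} (hX : LoopDegLE d X) (A B : RMat n) :
    LoopDegLE d (constLoop A * X * constLoop B) :=
  (((LoopDegLE.constLoop A).mul hX).mul (.constLoop B)).mono (by omega)

/-- The right side is the gauge transform from `dressing_gauge` of the polynomial part of `S`. So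
dressing a frame and dressing the series produce the same `t`-connection. -/
theorem polyPart_dressSeries {N : ℕ} {S : LoopMat n} (hS : LoopDegLE (N - 1) S) (Q : RMat n) {z : ℂ}
    (h₁ : z ≠ α₁) (h₂ : z ≠ α₂) :
    polyPart N (dressSeries α₁ α₂ Q S) z = polyPart N S z
      + (((α₁ : ℂ) - α₂) / (z - α₁)) •
        (cx (1 - Q) * (polyPart N S z - polyPart N S α₁) * cx Q)
      + (((α₂ : ℂ) - α₁) / (z - α₂)) •
        (cx Q * (polyPart N S z - polyPart N S α₂) * cx (1 - Q)) := by
  have key : ∀ (α α' : ℝ) (A B : RMat n), z ≠ α →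
      polyPart N (loopScalar α α' • (constLoop A * S * constLoop B)) z
        = (((α : ℂ) - α') / (z - α)) •
          (cx A * (polyPart N S z - polyPart N S α) * cx B) := by
    intro α α' A B hz
    have hz' := sub_ne_zero.mpr hz
    rw [← sub_smul_polyPart_resolvent hS, loopScalar_smul, ← loop_smul_mul (resolvent α),
      ← loop_mul_smul (resolvent α), polyPart_C_smul, polyPart_constLoop_mul_mul, mul_smul_comm, smul_mul_assoc,
      smul_smul,
      div_mul_cancel₀ _ hz', Complex.ofReal_sub]
  rw [dressSeries_eq, polyPart_add, polyPart_add, key _ _ _ _ h₁, key _ _ _ _ h₂]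

/-- `βλ + u` as a formal series. -/
def laxSeries (u : RMat n) : LoopMat n := lam • constLoop (beta n) + constLoop u

/-- Since `laxSeries u - A_i = (λ - α_i) β`, every pole cancels and only a constant remains,
assembled from `(1 - Q) β Q` and `Q β (1 - Q)` into the commutator. -/
theorem laxSeries_gauge {Q u A₁ A₂ Q' : RMat n} (hQ : Q * Q = Q) (hA₁ : A₁ = α₁ • beta n + u)
    (hA₂ : A₂ = α₂ • beta n + u) (hQ' : Q' = Q * A₂ * (1 - Q) - (1 - Q) * A₁ * Q) :
    hSeries α₁ α₂ Q * laxSeries u * hSeries α₂ α₁ Q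
        + loopScalar α₁ α₂ • (constLoop Q' * hSeries α₂ α₁ Q)
      = laxSeries (u + (α₁ - α₂) • ⁅beta n, Q⁆) := by
  have hD : constLoop Q' = constLoop Q * constLoop A₂ * (1 - constLoop Q)
      - (1 - constLoop Q) * constLoop A₁ * constLoop Q := by
    rw [hQ', constLoop_sub, constLoop_mul, constLoop_mul, constLoop_mul, constLoop_mul,
      constLoop_one_sub]
  have h1 := dressing_gauge (loopScalar_mul α₁ α₂) (X := laxSeries u) (constLoop_idem hQ) hD
  have hsub : ∀ (α : ℝ) (A : RMat n), A = α • beta n + u →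
      laxSeries u - constLoop A = (lam - HahnSeries.C α) • constLoop (beta n) := by
    intro α A hA
    rw [hA, laxSeries, constLoop_add, constLoop_smul, loop_sub_smul]
    abel
  have hscal : ∀ α α' : ℝ, ∀ X : LoopMat n,
      loopScalar α α' • (lam - HahnSeries.C α) • X
        = (HahnSeries.C (α - α') : LaurentSeries ℝ) • X := by
    intro α α' X
    rw [loop_smul_smul, loopScalar]
    congr 1
    linear_combination HahnSeries.C (α - α') * sub_mul_resolvent α
  rw [hsub _ _ hA₁, hsub _ _ hA₂] at h1
  rw [hSeries_eq, hSeries_eq]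
  refine h1.trans ?_
  rw [loop_mul_smul, loop_smul_mul, hscal, loop_mul_smul, loop_smul_mul, hscal,
    ← constLoop_one_sub, ← constLoop_mul, ← constLoop_mul, ← constLoop_mul, ← constLoop_mul,
    ← constLoop_smul, ← constLoop_smul, laxSeries, laxSeries, constLoop_add, Ring.lie_def,
    add_assoc, add_assoc, ← constLoop_add]
  congr 3
  simp only [mul_sub, sub_mul, one_mul, mul_one, smul_sub, sub_smul]
  abel

theorem hasLoopDerivAt_hSeries {Q : ℝ → RMat n} {Q' : RMat n} {s : ℝ}
    (hQ : HasMatrixDerivAt Q Q' s) :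
    HasLoopDerivAt (fun u => hSeries α₁ α₂ (Q u)) (-(loopScalar α₁ α₂ • constLoop Q')) s := by
  have h1 : LoopDegLE 0 (1 : LoopMat n) := by
    rw [← constLoop_one]
    exact .constLoop 1
  have h2 := (HasLoopDerivAt.const (s := s) h1).add
    ((HasLoopDerivAt.const (loopDegLE_loopScalar_smul (α₁ := α₁) (α₂ := α₂) h1)).mul
      (HasLoopDerivAt.constLoop ((HasMatrixDerivAt.const 1).sub hQ)))
  simp only [loop_smul_mul, one_mul, zero_mul, zero_add, zero_sub, constLoop_neg] at h2
  have h3 : loopScalar α₁ α₂ • -constLoop Q' = -(loopScalar α₁ α₂ • constLoop Q') :=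
    smul_neg (loopScalar α₁ α₂) (constLoop Q')
  rw [h3] at h2
  exact h2

theorem smoothLoopOn_hSeries {Ω : Set (ℝ × ℝ)} {Q : ℝ × ℝ → RMat n} (hQ : SmoothMatOn Ω Q) :
    SmoothLoopOn Ω fun p => hSeries α₁ α₂ (Q p) := by
  have h1 : LoopDegLE 0 (1 : LoopMat n) := by
    rw [← constLoop_one]
    exact .constLoop 1
  have h2 := (SmoothLoopOn.const (Ω := Ω) h1).add
    ((SmoothLoopOn.const (loopDegLE_loopScalar_smul (α₁ := α₁) (α₂ := α₂) h1)).mul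
      (SmoothLoopOn.constLoop ((SmoothMatOn.const 1).sub hQ)))
  simp only [loop_smul_mul, one_mul] at h2
  exact h2

theorem hasLoopDerivAt_dressSeries {Q : ℝ → RMat n} {T : ℝ → LoopMat n} {s : ℝ}
    {u A₁ A₂ : RMat n} (hidem : Q s * Q s = Q s) (hA₁ : A₁ = α₁ • beta n + u)
    (hA₂ : A₂ = α₂ • beta n + u)
    (hQ : HasMatrixDerivAt Q (Q s * A₂ * (1 - Q s) - (1 - Q s) * A₁ * Q s) s)
    (hT : HasLoopDerivAt T (T s * laxSeries u - laxSeries u * T s) s) :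
    HasLoopDerivAt (fun r => dressSeries α₁ α₂ (Q r) (T r))
      (dressSeries α₁ α₂ (Q s) (T s) * laxSeries (u + (α₁ - α₂) • ⁅beta n, Q s⁆)
        - laxSeries (u + (α₁ - α₂) • ⁅beta n, Q s⁆) * dressSeries α₁ α₂ (Q s) (T s)) s := by
  have h1 := ((hasLoopDerivAt_hSeries (α₁ := α₁) (α₂ := α₂) hQ).mul hT).mul
    (hasLoopDerivAt_hSeries (α₁ := α₂) (α₂ := α₁) hQ)
  rw [add_mul] at h1
  have hD : constLoop (Q s * A₂ * (1 - Q s) - (1 - Q s) * A₁ * Q s)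
      = constLoop (Q s) * constLoop A₂ * (1 - constLoop (Q s))
        - (1 - constLoop (Q s)) * constLoop A₁ * constLoop (Q s) := by
    rw [constLoop_sub, constLoop_mul, constLoop_mul, constLoop_mul, constLoop_mul,
      constLoop_one_sub]
  have h2 := dressing_deriv (loopScalar_mul α₁ α₂) (constLoop_idem hidem) hD
  have h3 := hSeries_mul_hSeries (α₁ := α₂) (α₂ := α₁) hidem
  rw [hSeries_eq, hSeries_eq] at h3
  have h4 := dressing_lax h3 h2 (T := T s) (L := laxSeries u)
  have h5 := laxSeries_gauge hidem hA₁ hA₂ rfl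
  rw [hSeries_eq, hSeries_eq] at h5
  rw [hSeries_eq, hSeries_eq] at h1
  have h6 := h1
  rw [show _ = _ from h4] at h6
  rw [dressSeries, hSeries_eq, hSeries_eq, ← h5]
  exact h6

end Series

section LaxFrame

variable {j : ℕ} {Ω : Set (ℝ × ℝ)} {q : ℝ × ℝ → RMat n} {T : ℝ × ℝ → LoopMat n}
  {K : ℝ × ℝ → ℂ → CMat n}

/-- A series `T` and a real loop family `K` that satisfy all conditions on `T(q, λ)` and on a
frame of `q`, except those that involve the bilinear form. -/
structure IsLaxFrameOn (n j : ℕ) (Ω : Set (ℝ × ℝ)) (q : ℝ × ℝ → RMat n) (T : ℝ × ℝ → LoopMat n)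
    (K : ℝ × ℝ → ℂ → CMat n) : Prop where
  family : IsRealLoopFamilyOn Ω K
  smooth : SmoothLoopOn Ω T
  top : ∀ p ∈ Ω, LoopDegLE 1 (T p)
  lead : ∀ p ∈ Ω, lcoeff 1 (T p) = beta n
  pow : ∀ p ∈ Ω, T p ^ (2 * n + 1) = lam • T p
  lax : ∀ p ∈ Ω, HasLoopDerivAt (fun s => T (s, p.2))
    (T p * laxSeries (bLow n + q p) - laxSeries (bLow n + q p) * T p) p.1
  eq_x : ∀ p ∈ Ω, ∀ z, HasMatrixDerivAt (fun s => K (s, p.2) z)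
    (K p z * (JB n z + cx (q p))) p.1
  eq_t : ∀ p ∈ Ω, ∀ z, HasMatrixDerivAt (fun s => K (p.1, s) z)
    (K p z * plusPart j (T p) z) p.2

namespace IsLaxFrameOn

theorem mono {Ω' : Set (ℝ × ℝ)} (h : IsLaxFrameOn n j Ω q T K) (hs : Ω' ⊆ Ω) :
    IsLaxFrameOn n j Ω' q T K where
  family := h.family.mono hs
  smooth := ⟨h.smooth.1.imp fun _ hd p hp => hd p (hs hp), fun i => (h.smooth.2 i).mono hs⟩
  top p hp := h.top p (hs hp)
  lead p hp := h.lead p (hs hp)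
  pow p hp := h.pow p (hs hp)
  lax p hp := h.lax p (hs hp)
  eq_x p hp := h.eq_x p (hs hp)
  eq_t p hp := h.eq_t p (hs hp)

/-- Hypothesis and conclusion have the same form, so the step can be iterated. Leaving out the
bilinear form is what makes this possible. -/
theorem dress (h : IsLaxFrameOn n j Ω q T K) (hΩ : IsOpen Ω) (hj : 1 ≤ j) {P : RMat n}
    {K' : ℝ × ℝ → ℂ → CMat n} {Q : ℝ × ℝ → RMat n} (hd : IsDressing Ω K K' α₁ α₂ P Q) :
    IsLaxFrameOn n j Ω (fun p => q p + (α₁ - α₂) • ⁅beta n, Q p⁆)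
      (fun p => dressSeries α₁ α₂ (Q p) (T p)) K' := by
  have hA : ∀ (p : ℝ × ℝ) (α : ℝ),
      JB n α + cx (q p) = cx (α • beta n + (bLow n + q p)) := by
    intro p α
    rw [JB, cx_add, cx_add, cx_smul, add_assoc]
  have hx := fun p hp => hd.hasMatrixDerivAt hΩ h.family (hasDerivAt_lineX p) hp (hA p α₁) (hA p α₂)
    (h.eq_x p hp)
  have hdeg : ∀ X : LoopMat n, LoopDegLE 1 X →
      ∀ (α α' : ℝ) (A B : RMat n),
      LoopDegLE 0 (loopScalar α α' • (constLoop A * X * constLoop B)) := fun X hX α α' A B =>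
    (loopDegLE_loopScalar_smul (loopDegLE_conj hX A B)).mono (by omega)
  refine ⟨hd.family, ?_, ?_, ?_, ?_, ?_, ?_, ?_⟩
  · exact ((smoothLoopOn_hSeries hd.smooth).mul h.smooth).mul (smoothLoopOn_hSeries hd.smooth)
  · intro p hp
    rw [dressSeries_eq]
    exact ((h.top p hp).add ((hdeg _ (h.top p hp) _ _ _ _).mono (by omega))).add
      ((hdeg _ (h.top p hp) _ _ _ _).mono (by omega))
  · intro p hp
    rw [dressSeries_eq, lcoeff_add, lcoeff_add, hdeg _ (h.top p hp) _ _ _ _ 1 (by omega),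
      hdeg _ (h.top p hp) _ _ _ _ 1 (by omega), add_zero, add_zero, h.lead p hp]
  · intro p hp
    rw [dressSeries_pow (hd.pullback p hp).idem, h.pow p hp, dressSeries, loop_mul_smul,
      loop_smul_mul, dressSeries]
  · intro p hp
    have := hasLoopDerivAt_dressSeries (Q := fun s => Q (s, p.2)) (T := fun s => T (s, p.2))
      (hd.pullback p hp).idem rfl rfl (hx p hp).1 (h.lax p hp)
    simp only [add_assoc] at this ⊢
    exact this
  · intro p hp
    refine (hx p hp).2 (fun z => JB n z + cx (q p + (α₁ - α₂) • ⁅beta n, Q p⁆)) ?_ ?_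
    · unfold JB
      fun_prop
    · intro z h₁ h₂
      have h₁' := sub_ne_zero.mpr h₁
      have h₂' := sub_ne_zero.mpr h₂
      have e : ∀ α : ℝ, JB n z + cx (q p) - cx (α • beta n + (bLow n + q p))
          = (z - α) • cx (beta n) := by
        intro α
        rw [← hA, JB, JB, sub_smul]
        abel
      change JB n z + cx (q p + (α₁ - α₂) • ⁅beta n, Q p⁆) = JB n z + cx (q p)
        + _ • (cx (1 - Q p) * _ * cx (Q p)) + _ • (cx (Q p) * _ * cx (1 - Q p))
      rw [e, e, mul_smul_comm, smul_mul_assoc, smul_smul, div_mul_cancel₀ _ h₁', mul_smul_comm,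
        smul_mul_assoc, smul_smul, div_mul_cancel₀ _ h₂', cx_add, cx_smul, Ring.lie_def, cx_sub,
        cx_sub, cx_mul, cx_mul, cx_one, Complex.ofReal_sub]
      simp only [mul_sub, sub_mul, one_mul, mul_one, smul_sub, sub_smul]
      abel
  · intro p hp
    -- The degree of `T^{2j-1}` is at most `2j - 1`, matching the `2j` powers summed in `plusPart`.
    have hS : LoopDegLE (((2 * j : ℕ) : ℤ) - 1) (T p ^ (2 * j - 1)) :=
      ((h.top p hp).pow _).mono (by omega)
    obtain ⟨A₁, hA₁⟩ := exists_polyPart_ofReal (2 * j) (T p ^ (2 * j - 1)) α₁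
    obtain ⟨A₂, hA₂⟩ := exists_polyPart_ofReal (2 * j) (T p ^ (2 * j - 1)) α₂
    refine (hd.hasMatrixDerivAt hΩ h.family (hasDerivAt_lineT p) hp (A := plusPart j (T p)) hA₁ hA₂
      (h.eq_t p hp)).2 (plusPart j (dressSeries α₁ α₂ (Q p) (T p))) ?_ ?_
    · exact continuous_polyPart _ _
    · intro z h₁ h₂
      rw [plusPart_eq, plusPart_eq, dressSeries_pow (hd.pullback p hp).idem,
        polyPart_dressSeries hS _ h₁ h₂, hA₁, hA₂]

end IsLaxFrameOn

end LaxFrame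

end FormalDressing

/-! ### Adjoints, triangularity, and consequences of differentiating frames. -/

section BilinearForm

variable {n : ℕ}

section Adjoint

variable {ι R : Type*} [Fintype ι] [DecidableEq ι] [CommRing R]

/-- The adjoint of `A` with respect to the bilinear form of an involutive symmetric matrix `r`. -/
def formAdjoint (r A : Matrix ι ι R) : Matrix ι ι R := r * Aᵀ * r

theorem formAdjoint_mul {r : Matrix ι ι R} (hr : r * r = 1) (A B : Matrix ι ι R) :
    formAdjoint r (A * B) = formAdjoint r B * formAdjoint r A := by
  simp only [formAdjoint, Matrix.transpose_mul]
  rw [show r * Bᵀ * r * (r * Aᵀ * r) = r * Bᵀ * (r * r) * Aᵀ * r by noncomm_ring, hr, mul_one]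
  noncomm_ring

theorem formAdjoint_one_add_smul {r : Matrix ι ι R} (hr : r * r = 1) (u : R) (A : Matrix ι ι R) :
    formAdjoint r (1 + u • A) = 1 + u • formAdjoint r A := by
  rw [formAdjoint, Matrix.transpose_add, Matrix.transpose_one, Matrix.transpose_smul, mul_add,
    mul_one, add_mul, hr, Matrix.mul_smul, Matrix.smul_mul, formAdjoint]

theorem formAdjoint_mul_self_eq_one {r A : Matrix ι ι R} (hr : r * r = 1) :
    formAdjoint r A * A = 1 ↔ Aᵀ * r * A = r := by
  rw [formAdjoint]
  constructor <;> intro h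
  · have := congrArg (r * ·) h
    simpa only [← mul_assoc, hr, one_mul, mul_one] using this
  · have := congrArg (r * ·) h
    simpa only [← mul_assoc, hr] using this

theorem skew_iff_formAdjoint {r A : Matrix ι ι R} (hr : r * r = 1) :
    Aᵀ * r + r * A = 0 ↔ formAdjoint r A = -A := by
  rw [formAdjoint, ← add_eq_zero_iff_eq_neg]
  constructor <;> intro h
  · have := congrArg (r * ·) h
    simpa only [mul_add, ← mul_assoc, hr, one_mul, mul_zero] using this
  · have := congrArg (r * ·) h
    simpa only [mul_add, ← mul_assoc, hr, one_mul, mul_zero] using this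

end Adjoint

section Form

theorem rho_apply (a b : Fin (2 * n + 1)) :
    rho n a b = if b = Fin.rev a then (-1) ^ (n + (a : ℕ)) else 0 := by
  have : (a : ℕ) + b = 2 * n ↔ b = Fin.rev a := by
    rw [Fin.ext_iff, Fin.val_rev]
    omega
  simp only [rho, Matrix.of_apply, this]

theorem rho_mul_apply (A : RMat n) (a b) :
    (rho n * A) a b = (-1) ^ (n + (a : ℕ)) * A (Fin.rev a) b := by
  simp [Matrix.mul_apply, rho_apply]

/-- Reversal replaces the index `a` by `2n - a`, of the same parity. Hence `ρ` is symmetric and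
squares to `1`. -/
theorem neg_one_pow_rev (a : Fin (2 * n + 1)) :
    (-1 : ℝ) ^ (n + (Fin.rev a : ℕ)) = (-1) ^ (n + (a : ℕ)) := by
  rw [neg_one_pow_eq_pow_mod_two, neg_one_pow_eq_pow_mod_two (n := n + (a : ℕ)), Fin.val_rev]
  congr 1
  omega

theorem rho_transpose : (rho n)ᵀ = rho n := by
  ext a b
  rw [Matrix.transpose_apply, rho_apply, rho_apply]
  by_cases h : a = Fin.rev b
  · subst h
    rw [neg_one_pow_rev]
    simp
  · have : ¬ b = Fin.rev a := fun h' => h (by rw [h', Fin.rev_rev])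
    simp [h, this]

theorem rho_mul_rho : rho n * rho n = 1 := by
  ext a b
  rw [rho_mul_apply, rho_apply, Fin.rev_rev, neg_one_pow_rev, Matrix.one_apply]
  by_cases h : a = b
  · subst h
    simp [← mul_pow]
  · simp [h, Ne.symm h]

theorem mul_rho_apply (A : RMat n) (a b) :
    (A * rho n) a b = (-1) ^ (n + (b : ℕ)) * A a (Fin.rev b) := by
  have := congrFun (congrFun (congrArg Matrix.transpose (Matrix.transpose_mul A (rho n))) a) b
  rw [Matrix.transpose_transpose] at this
  rw [this, Matrix.transpose_apply, rho_transpose, rho_mul_apply, Matrix.transpose_apply]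

theorem sharp_eq (A : RMat n) : sharp A = formAdjoint (rho n) A := rfl

theorem sharp_sharp (A : RMat n) : sharp (sharp A) = A := by
  simp only [sharp, Matrix.transpose_mul, Matrix.transpose_transpose, rho_transpose]
  rw [show rho n * (rho n * (A * rho n)) * rho n = (rho n * rho n) * A * (rho n * rho n) by
    noncomm_ring, rho_mul_rho, one_mul, mul_one]

theorem sharp_one_sub (A : RMat n) : sharp (1 - A) = 1 - sharp A := by
  simp only [sharp, Matrix.transpose_sub, Matrix.transpose_one, mul_sub, sub_mul, mul_one,
    rho_mul_rho]

theorem sharp_mul_self {P : RMat n} (hP : P * P = P) : sharp P * sharp P = sharp P := by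
  rw [sharp_eq, ← formAdjoint_mul rho_mul_rho, hP]

theorem cxRho_mul_cxRho : cx (rho n) * cx (rho n) = 1 := by rw [← cx_mul, rho_mul_rho, cx_one]

theorem constRho_mul_constRho : constLoop (rho n) * constLoop (rho n) = 1 := by
  rw [← constLoop_mul, rho_mul_rho, constLoop_one]

theorem cx_sharp (A : RMat n) : cx (sharp A) = formAdjoint (cx (rho n)) (cx A) := by
  rw [sharp, cx_mul, cx_mul, cx_transpose, formAdjoint]

theorem constLoop_sharp (A : RMat n) :
    constLoop (sharp A) = formAdjoint (constLoop (rho n)) (constLoop A) := by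
  rw [sharp, constLoop_mul, constLoop_mul, constLoop_transpose, formAdjoint]

theorem formAdjoint_hLoop (α₁ α₂ : ℝ) (P : RMat n) (z : ℂ) :
    formAdjoint (cx (rho n)) (hLoop α₁ α₂ P z) = hLoop α₁ α₂ (sharp P) z := by
  rw [hLoop, formAdjoint_one_add_smul cxRho_mul_cxRho, ← cx_sharp, sharp_one_sub, hLoop]

theorem formAdjoint_hSeries (α₁ α₂ : ℝ) (P : RMat n) :
    formAdjoint (constLoop (rho n)) (hSeries α₁ α₂ P) = hSeries α₁ α₂ (sharp P) := by
  rw [hSeries, hSeries, ← sharp_one_sub, constLoop_sharp]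
  exact formAdjoint_one_add_smul constRho_mul_constRho _ _

/-- `⟨P w, x⟩ = w · Pᵀ ρ x`, so orthogonality to `Im P` means `Pᵀ ρ x = 0`. With `perp_ker` it turns
the second half of the construction into a Darboux step for `P^♯`. -/
theorem perp_im (P : RMat n) : perp (im P) = ker (sharp P) := by
  ext x
  have h1 : x ∈ perp (im P) ↔ ∀ w, w ⬝ᵥ (Pᵀ *ᵥ (rho n *ᵥ x)) = 0 := by
    rw [perp, LinearMap.BilinForm.mem_orthogonal_iff]
    constructor
    · intro h w
      have := h (P *ᵥ w) ⟨w, rfl⟩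
      rw [Matrix.toBilin'_apply'] at this
      rw [Matrix.dotProduct_mulVec, Matrix.vecMul_transpose]
      exact this
    · rintro h _ ⟨w, rfl⟩
      rw [Matrix.toBilin'_apply', Matrix.toLin'_apply,
        ← Matrix.vecMul_transpose, ← Matrix.dotProduct_mulVec]
      exact h w
  rw [h1, mem_ker_iff, sharp, mul_assoc, ← Matrix.mulVec_mulVec, ← Matrix.mulVec_mulVec]
  constructor
  · intro h
    have h2 : Pᵀ *ᵥ (rho n *ᵥ x) = 0 := dotProduct_self_eq_zero.mp (h _)
    rw [h2, Matrix.mulVec_zero]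
  · intro h w
    have := congrArg (rho n *ᵥ ·) h
    simp only [Matrix.mulVec_mulVec, ← mul_assoc, rho_mul_rho, one_mul, Matrix.mulVec_zero] at this
    rw [Matrix.mulVec_mulVec, this, dotProduct_zero]

theorem im_one_sub {P : RMat n} (hP : P * P = P) : im (1 - P) = ker P := by
  have h : (1 - P) * (1 - P) = 1 - P := by
    rw [sub_mul, mul_sub, mul_sub, hP]
    simp
  ext v
  rw [mem_im_iff h, mem_ker_iff, Matrix.sub_mulVec, Matrix.one_mulVec, sub_eq_self]

theorem perp_ker {P : RMat n} (hP : P * P = P) : perp (ker P) = im (sharp P) := by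
  have h := sharp_mul_self hP
  have h' : (1 - sharp P) * (1 - sharp P) = 1 - sharp P := by
    rw [sub_mul, mul_sub, mul_sub, h]
    simp
  rw [← im_one_sub hP, perp_im, sharp_one_sub, ← im_one_sub h', sub_sub_cancel]

end Form

section Triangular

/-- `β` has its entries in the upper right corner, so below the diagonal the commutator only sees
the bottom left entry of `X`. It occurs with opposite signs at the first and last places of the
subdiagonal. -/
theorem beta_bracket_apply (X : RMat n) {a b : Fin (2 * n + 1)} (hab : b < a) :
    ⁅beta n, X⁆ a b = (if (a : ℕ) = 1 then X (Fin.last _) 0 / 2 else 0)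
      - (if (b : ℕ) + 1 = 2 * n then X (Fin.last _) 0 / 2 else 0) := by
  have hab' : (b : ℕ) < a := hab
  rw [Ring.lie_def, Matrix.sub_apply, Matrix.mul_apply, Matrix.mul_apply]
  congr 1
  · rw [Finset.sum_eq_single (Fin.last (2 * n))]
    · by_cases h : (a : ℕ) = 1
      · have hb : b = 0 := by
          ext
          change (b : ℕ) = 0
          omega
        subst hb
        simp [beta, h]
        ring
      · simp [beta, h]
    · intro c _ hc
      have hc' : (c : ℕ) ≠ 2 * n := fun h => hc (Fin.ext h)
      have : a ≠ 0 := fun h => by simp [h] at hab'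
      simp [beta, hc', this]
    · simp
  · rw [Finset.sum_eq_single 0]
    · by_cases h : (b : ℕ) + 1 = 2 * n
      · have ha : a = Fin.last (2 * n) := by
          ext
          simp
          omega
        subst ha
        simp [beta, h]
        ring
      · simp [beta, h]
    · intro c _ hc
      have hc' : (c : ℕ) ≠ 0 := fun h => hc (Fin.ext h)
      have : (b : ℕ) ≠ 2 * n := by omega
      simp [beta, hc, this]
    · simp

/-- Skewness forces the first and the last subdiagonal entry to be equal; for a multiple of `[β, X]`
they are opposite, so both vanish. -/
theorem upperTriangular_of_skew (hn : 1 ≤ n) {c : ℝ} {X : RMat n}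
    (h : (c • ⁅beta n, X⁆)ᵀ * rho n + rho n * (c • ⁅beta n, X⁆) = 0) {a b : Fin (2 * n + 1)}
    (hab : b < a) : (c • ⁅beta n, X⁆) a b = 0 := by
  set i : Fin (2 * n + 1) := ⟨2 * n - 1, by omega⟩
  have hi : Fin.rev i = ⟨1, by omega⟩ := by
    ext
    simp [i]
    omega
  -- This entry of the skewness equation compares exactly the two possibly nonzero places; the signs
  -- of `ρ` there differ because `2n - 1` is odd.
  have h1 := congrFun (congrFun h i) 0
  rw [Matrix.add_apply, mul_rho_apply, rho_mul_apply, Matrix.transpose_apply, Matrix.smul_apply,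
    Matrix.smul_apply, hi, Fin.rev_zero, beta_bracket_apply X (b := i) (a := Fin.last _)
      (by rw [Fin.lt_def]; simp [i]; omega),
    beta_bracket_apply X (b := 0) (a := ⟨1, by omega⟩) (by rw [Fin.lt_def]; simp)] at h1
  have e1 : (i : ℕ) + 1 = 2 * n := by simp [i]; omega
  have e2 : ((Fin.last (2 * n) : Fin (2 * n + 1)) : ℕ) ≠ 1 := by simp
  have e3 : ((0 : Fin (2 * n + 1)) : ℕ) + 1 ≠ 2 * n := by
    change 0 + 1 ≠ 2 * n
    omega
  have e4 : (-1 : ℝ) ^ (n + (i : ℕ)) = -(-1) ^ (n + ((0 : Fin (2 * n + 1)) : ℕ)) := by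
    have : n + (i : ℕ) + 1 = n + 2 * n := by omega
    have h2 : (-1 : ℝ) ^ (n + (i : ℕ) + 1) = (-1) ^ n := by
      rw [this, pow_add, pow_mul]
      simp
    rw [pow_succ] at h2
    simp only [Fin.val_zero, add_zero]
    linarith
  rw [if_neg e2, if_pos e1, if_pos rfl, if_neg e3, e4, Matrix.zero_apply] at h1
  have h3 : c * (X (Fin.last _) 0 / 2) = 0 := by
    have h4 : ((-1 : ℝ) ^ (n + ((0 : Fin (2 * n + 1)) : ℕ))) ≠ 0 :=
      pow_ne_zero _ (by norm_num)
    refine (mul_eq_zero.mp ?_).resolve_left h4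
    simp only [smul_eq_mul] at h1
    linarith
  rw [Matrix.smul_apply, beta_bracket_apply X hab, smul_eq_mul, mul_sub]
  split_ifs <;> simp [h3]

end Triangular

section Derivatives

variable {Ω : Set (ℝ × ℝ)}

theorem HasMatrixDerivAt.pdx_eq {E : Type} [NormedRing E] [NormedAlgebra ℝ E]
    {f : ℝ × ℝ → Matrix (Fin (2 * n + 1)) (Fin (2 * n + 1)) E} {p : ℝ × ℝ} {D}
    (h : HasMatrixDerivAt (fun s => f (s, p.2)) D p.1) : pdx f p = D := by
  ext a b
  exact (h a b).deriv

theorem HasMatrixDerivAt.pdt_eq {E : Type} [NormedRing E] [NormedAlgebra ℝ E]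
    {f : ℝ × ℝ → Matrix (Fin (2 * n + 1)) (Fin (2 * n + 1)) E} {p : ℝ × ℝ} {D}
    (h : HasMatrixDerivAt (fun s => f (p.1, s)) D p.2) : pdt f p = D := by
  ext a b
  exact (h a b).deriv

theorem SmoothMatOn.hasMatrixDerivAt_pdx {E : Type} [NormedField E] [NormedAlgebra ℝ E]
    {f : ℝ × ℝ → Matrix (Fin (2 * n + 1)) (Fin (2 * n + 1)) E} (h : SmoothMatOn Ω f)
    (hΩ : IsOpen Ω) {p : ℝ × ℝ} (hp : p ∈ Ω) :
    HasMatrixDerivAt (fun s => f (s, p.2)) (pdx f p) p.1 := by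
  obtain ⟨D, hD⟩ := h.exists_hasMatrixDerivAt hΩ (hasDerivAt_lineX p) hp
  exact hD.pdx_eq ▸ hD

theorem SmoothMatOn.hasMatrixDerivAt_pdt {E : Type} [NormedField E] [NormedAlgebra ℝ E]
    {f : ℝ × ℝ → Matrix (Fin (2 * n + 1)) (Fin (2 * n + 1)) E} (h : SmoothMatOn Ω f)
    (hΩ : IsOpen Ω) {p : ℝ × ℝ} (hp : p ∈ Ω) :
    HasMatrixDerivAt (fun s => f (p.1, s)) (pdt f p) p.2 := by
  obtain ⟨D, hD⟩ := h.exists_hasMatrixDerivAt hΩ (hasDerivAt_lineT p) hp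
  exact hD.pdt_eq ▸ hD

theorem mixed_derivatives_eq (hΩ : IsOpen Ω) {g gx gt : ℝ × ℝ → ℂ} (hg : ContDiffOn ℝ ∞ g Ω)
    (hgx : ∀ p ∈ Ω, HasDerivAt (fun s => g (s, p.2)) (gx p) p.1)
    (hgt : ∀ p ∈ Ω, HasDerivAt (fun s => g (p.1, s)) (gt p) p.2) {p : ℝ × ℝ} (hp : p ∈ Ω) {a b : ℂ}
    (ha : HasDerivAt (fun s => gx (p.1, s)) a p.2) (hb : HasDerivAt (fun s => gt (s, p.2)) b p.1) :
    a = b := by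
  have hd : ∀ p ∈ Ω, HasFDerivAt g (fderiv ℝ g p) p := fun p hp =>
    ((hg.differentiableOn (by simp)).differentiableAt (hΩ.mem_nhds hp)).hasFDerivAt
  have hd2 : HasFDerivAt (fderiv ℝ g) (fderiv ℝ (fderiv ℝ g) p) p :=
    ((((contDiffOn_infty_iff_fderiv_of_isOpen hΩ).mp hg).2.differentiableOn
      (by simp)).differentiableAt (hΩ.mem_nhds hp)).hasFDerivAt
  have hx : ∀ p ∈ Ω, gx p = fderiv ℝ g p (1, 0) := fun p hp =>
    (hgx p hp).unique ((hd p hp).comp_hasDerivAt (f := fun s : ℝ => (s, p.2)) p.1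
      (hasDerivAt_lineX p))
  have ht : ∀ p ∈ Ω, gt p = fderiv ℝ g p (0, 1) := fun p hp =>
    (hgt p hp).unique ((hd p hp).comp_hasDerivAt (f := fun s : ℝ => (p.1, s)) p.2
      (hasDerivAt_lineT p))
  have h1 : HasDerivAt (fun s => fderiv ℝ g (p.1, s) (1, 0))
      (fderiv ℝ (fderiv ℝ g) p (0, 1) (1, 0)) p.2 := by
    have := (HasFDerivAt.comp_hasDerivAt (f := fun s : ℝ => (p.1, s)) p.2 hd2
      (hasDerivAt_lineT p)).clm_apply (hasDerivAt_const p.2 ((1, 0) : ℝ × ℝ))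
    simpa using this
  have h2 : HasDerivAt (fun s => fderiv ℝ g (s, p.2) (0, 1))
      (fderiv ℝ (fderiv ℝ g) p (1, 0) (0, 1)) p.1 := by
    have := (HasFDerivAt.comp_hasDerivAt (f := fun s : ℝ => (s, p.2)) p.1 hd2
      (hasDerivAt_lineX p)).clm_apply (hasDerivAt_const p.1 ((0, 1) : ℝ × ℝ))
    simpa using this
  have ev1 : ∀ᶠ s in 𝓝 p.2, (p.1, s) ∈ Ω :=
    (hasDerivAt_lineT p).continuousAt.eventually (hΩ.mem_nhds hp)
  have ev2 : ∀ᶠ s in 𝓝 p.1, (s, p.2) ∈ Ω :=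
    (hasDerivAt_lineX p).continuousAt.eventually (hΩ.mem_nhds hp)
  have e1 := ha.unique (h1.congr_of_eventuallyEq (ev1.mono fun s hs => hx _ hs))
  have e2 := hb.unique (h2.congr_of_eventuallyEq (ev2.mono fun s hs => ht _ hs))
  have hsymm : IsSymmSndFDerivAt ℝ g p :=
    ((hg p hp).contDiffAt (hΩ.mem_nhds hp)).isSymmSndFDerivAt (by
      rw [minSmoothness_of_isRCLikeNormedField]
      exact WithTop.coe_le_coe.mpr (le_top : (2 : ℕ∞) ≤ ⊤))
  rw [e1, e2]
  exact hsymm _ _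

/-- Equality of the mixed derivatives of `f`, after cancelling the invertible factor `f`. -/
theorem zero_curvature (hΩ : IsOpen Ω) {f : ℝ × ℝ → CMat n} (hf : SmoothMatOn Ω f)
    (hdet : ∀ p ∈ Ω, IsUnit (f p).det) {X Y : ℝ × ℝ → RMat n} (hX : SmoothMatOn Ω X)
    (hY : SmoothMatOn Ω Y)
    (hfx : ∀ p ∈ Ω, HasMatrixDerivAt (fun s => f (s, p.2)) (f p * cx (X p)) p.1)
    (hft : ∀ p ∈ Ω, HasMatrixDerivAt (fun s => f (p.1, s)) (f p * cx (Y p)) p.2)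
    {p : ℝ × ℝ} (hp : p ∈ Ω) : pdt X p = pdx Y p + ⁅X p, Y p⁆ := by
  have h1 := (hft p hp).mul (hX.hasMatrixDerivAt_pdt hΩ hp).cx
  have h2 := (hfx p hp).mul (hY.hasMatrixDerivAt_pdx hΩ hp).cx
  have h3 : f p * cx (Y p) * cx (X p) + f p * cx (pdt X p)
      = f p * cx (X p) * cx (Y p) + f p * cx (pdx Y p) := by
    ext a b
    exact mixed_derivatives_eq hΩ (hf a b) (gx := fun p => (f p * cx (X p)) a b)
      (gt := fun p => (f p * cx (Y p)) a b) (fun p hp => hfx p hp a b) (fun p hp => hft p hp a b)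
      hp (h1 a b) (h2 a b)
  rw [mul_assoc, mul_assoc, ← mul_add, ← mul_add, ← cx_mul, ← cx_mul, ← cx_add, ← cx_add] at h3
  have h4 := congrArg ((f p)⁻¹ * ·) h3
  simp only [← mul_assoc, Matrix.nonsing_inv_mul _ (hdet p hp), one_mul] at h4
  have h5 := cx_injective h4
  rw [Ring.lie_def]
  rw [← sub_eq_zero] at h5 ⊢
  rw [← h5]
  abel

theorem HasMatrixDerivAt.transpose {R : Type*} [NormedRing R] [NormedAlgebra ℝ R] {ι : Type*}
    {f : ℝ → Matrix ι ι R} {f' : Matrix ι ι R} {s : ℝ} (hf : HasMatrixDerivAt f f' s) :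
    HasMatrixDerivAt (fun u => (f u)ᵀ) f'ᵀ s := fun a b => hf b a

/-- The logarithmic derivative of a curve of orthogonal matrices is skew-adjoint. -/
theorem skew_of_orthogonal {f : ℝ → CMat n} {A : CMat n} {s : ℝ}
    (hf : HasMatrixDerivAt f (f s * A) s)
    (ho : ∀ᶠ u in 𝓝 s, (f u)ᵀ * cx (rho n) * f u = cx (rho n)) :
    Aᵀ * cx (rho n) + cx (rho n) * A = 0 := by
  have h1 := (hf.transpose.mul (HasMatrixDerivAt.const (cx (rho n)))).mul hf
  have h2 := h1.unique ((HasMatrixDerivAt.const (cx (rho n))).congr_of_eventuallyEq ho)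
  rw [← h2, Matrix.transpose_mul, mul_zero, add_zero, mul_assoc Aᵀ, mul_assoc Aᵀ,
    ho.self_of_nhds, ← mul_assoc, ho.self_of_nhds]

end Derivatives

end BilinearForm

/-! ### From Lax frames to frames and solutions; orthogonality by Liouville. -/

section Orthogonal

variable {n j : ℕ} {α₁ α₂ : ℝ}

section Conversion

variable {Ω : Set (ℝ × ℝ)} {q : ℝ × ℝ → RMat n} {T : ℝ × ℝ → LoopMat n} {F : ℝ × ℝ → ℂ → CMat n}

theorem lcoeff_laxSeries_bracket (X : LoopMat n) (u : RMat n) (i : ℤ) :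
    lcoeff i (X * laxSeries u - laxSeries u * X)
      = -(⁅u, lcoeff i X⁆ + ⁅beta n, lcoeff (i - 1) X⁆) := by
  rw [laxSeries, mul_add, add_mul, loop_mul_smul, loop_smul_mul, lcoeff_sub, lcoeff_add,
    lcoeff_add, lcoeff_lam_smul, lcoeff_lam_smul, lcoeff_mul_constLoop, lcoeff_mul_constLoop,
    lcoeff_constLoop_mul, lcoeff_constLoop_mul, Ring.lie_def, Ring.lie_def]
  abel

theorem IsFrameOn.isRealLoopFamilyOn (hF : IsFrameOn n j Ω q F) : IsRealLoopFamilyOn Ω F :=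
  ⟨hF.smooth, hF.holo, fun p hp z => by rw [(hF.mem p hp z).1]; exact isUnit_one, hF.real⟩

theorem IsT.smoothLoopOn (hT : IsT n Ω q T) : SmoothLoopOn Ω T :=
  ⟨⟨1, hT.top⟩, hT.smooth⟩

theorem IsFrameOn.exists_isLaxFrameOn (hF : IsFrameOn n j Ω q F) (hΩ : IsOpen Ω) :
    ∃ T, IsT n Ω q T ∧ IsLaxFrameOn n j Ω q T F := by
  obtain ⟨T, hT, ht⟩ := hF.eq_t
  have hfam := hF.isRealLoopFamilyOn
  have hinv : ∀ p ∈ Ω, ∀ z (X Y : CMat n), (F p z)⁻¹ * X = Y → X = F p z * Y := by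
    rintro p hp z X _ rfl
    rw [← mul_assoc, Matrix.mul_nonsing_inv _ (hfam.det p hp z), one_mul]
  refine ⟨T, hT, hfam, hT.smoothLoopOn, hT.top, hT.lead, hT.pow, fun p hp => ?_,
    fun p hp z => ?_, fun p hp z => ?_⟩
  · refine ⟨⟨1, ?_⟩, fun i => ?_⟩
    · exact ((hasDerivAt_lineX p).continuousAt.eventually (hΩ.mem_nhds hp)).mono
        fun u hu => hT.top _ hu
    · have h1 : HasMatrixDerivAt (fun s => lcoeff i (T (s, p.2)))
          (pdx (fun p' => lcoeff i (T p')) p) p.1 :=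
        SmoothMatOn.hasMatrixDerivAt_pdx (f := fun p' => lcoeff i (T p')) (hT.smooth i) hΩ hp
      have h2 := hT.comm p hp i
      rw [add_assoc] at h2
      rw [lcoeff_laxSeries_bracket, ← eq_neg_of_add_eq_zero_left h2]
      exact h1
  · rw [← hinv p hp z _ _ (hF.eq_x p hp z)]
    exact (hfam.smooth_apply z).hasMatrixDerivAt_pdx hΩ hp
  · rw [← hinv p hp z _ _ (ht p hp z)]
    exact (hfam.smooth_apply z).hasMatrixDerivAt_pdt hΩ hp

namespace IsLaxFrameOn

theorem isT (h : IsLaxFrameOn n j Ω q T F)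
    (hs : ∀ p ∈ Ω, (T p)ᵀ * constLoop (rho n) + constLoop (rho n) * T p = 0) : IsT n Ω q T where
  smooth := h.smooth.2
  skew := hs
  top := h.top
  lead := h.lead
  comm p hp i := by
    have := ((h.lax p hp).2 i).pdx_eq (f := fun p' => lcoeff i (T p'))
    rw [this, lcoeff_laxSeries_bracket]
    abel
  pow := h.pow

theorem isFrameOn (h : IsLaxFrameOn n j Ω q T F)
    (hT : IsT n Ω q T) (hF : ∀ p ∈ Ω, ∀ z, MemOC (F p z)) : IsFrameOn n j Ω q F where
  smooth := h.family.smooth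
  holo := h.family.holo
  mem := hF
  real := h.family.real
  eq_x p hp z := by
    rw [(h.eq_x p hp z).pdx_eq (f := fun p' => F p' z), ← mul_assoc,
      Matrix.nonsing_inv_mul _ (h.family.det p hp z), one_mul]
  eq_t := ⟨T, hT, fun p hp z => by
    rw [(h.eq_t p hp z).pdt_eq (f := fun p' => F p' z), ← mul_assoc,
      Matrix.nonsing_inv_mul _ (h.family.det p hp z), one_mul]⟩

/-- At `λ = 0` the two connections reduce to `b + q` and `T_{2j-1,0}`, and their zero curvature
equation is the flow. -/
theorem flow (h : IsLaxFrameOn n j Ω q T F) (hΩ : IsOpen Ω) (hj : 1 ≤ j) (hq : SmoothMatOn Ω q)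
    {p : ℝ × ℝ} (hp : p ∈ Ω) :
    pdt q p = pdx (fun p' => lcoeff 0 (T p' ^ (2 * j - 1))) p
      + ⁅bLow n + q p, lcoeff 0 (T p ^ (2 * j - 1))⁆ := by
  have hX : SmoothMatOn Ω fun p => bLow n + q p := (SmoothMatOn.const _).add hq
  have h0 := zero_curvature hΩ (f := fun p => F p 0) (h.family.smooth_apply 0)
    (fun p hp => h.family.det p hp 0) hX ((h.smooth.pow (2 * j - 1)).2 0)
    (fun p hp => by
      have := h.eq_x p hp 0
      rwa [JB, zero_smul, zero_add, ← cx_add] at this)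
    (fun p hp => by
      have := h.eq_t p hp 0
      have e : plusPart j (T p) 0 = cx (lcoeff 0 (T p ^ (2 * j - 1))) := by
        rw [plusPart, Finset.sum_eq_single 0]
        · simp
        · intro i _ hi
          rw [zero_pow hi, zero_smul]
        · intro h'
          simp at h'
          omega
      rwa [e] at this) hp
  rw [← h0]
  have h1 := hq.hasMatrixDerivAt_pdt hΩ hp
  have h2 := (HasMatrixDerivAt.const (bLow n)).add h1
  rw [zero_add] at h2
  exact (h2.pdt_eq (f := fun p => bLow n + q p)).symm

theorem skew_potential (h : IsLaxFrameOn n j Ω q T F) (hΩ : IsOpen Ω)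
    (hF : ∀ p ∈ Ω, ∀ z, MemOC (F p z)) {p : ℝ × ℝ} (hp : p ∈ Ω) :
    (bLow n + q p)ᵀ * rho n + rho n * (bLow n + q p) = 0 := by
  have h1 := h.eq_x p hp 0
  rw [JB, zero_smul, zero_add, ← cx_add] at h1
  have h2 := skew_of_orthogonal (f := fun s => F (s, p.2) 0) h1
    (((hasDerivAt_lineX p).continuousAt.eventually (hΩ.mem_nhds hp)).mono
      fun u hu => (hF _ hu 0).2)
  rw [← cx_transpose, ← cx_mul, ← cx_mul, ← cx_add] at h2
  exact cx_injective (h2.trans cx_zero.symm)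

end IsLaxFrameOn

end Conversion

section Orthogonality

theorem commute_hLoop {A B : RMat n} (h : A * B = B * A) (z : ℂ) :
    hLoop α₁ α₂ A z * hLoop α₁ α₂ B z = hLoop α₁ α₂ B z * hLoop α₁ α₂ A z := by
  have e : cx (1 - A) * cx (1 - B) = cx (1 - B) * cx (1 - A) := by
    rw [← cx_mul, ← cx_mul]
    congr 1
    simp only [mul_sub, sub_mul, one_mul, mul_one, h]
    abel
  simp only [hLoop, mul_add, add_mul, one_mul, mul_one, smul_mul_assoc, mul_smul_comm, smul_add, e]
  abel

/-- The adjoint of `g` is `h_{α₁,α₂,P^♯} h_{α₂,α₁,P}`. Commutativity of `P` and `P^♯` permits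
exchanging the two middle factors, after which everything cancels in pairs. -/
theorem formAdjoint_gLoop_mul_gLoop {P : RMat n} (hP : P * P = P)
    (hc : P * sharp P = sharp P * P) {z : ℂ} (h₁ : z ≠ α₁) (h₂ : z ≠ α₂) :
    formAdjoint (cx (rho n)) (gLoop α₁ α₂ P z) * gLoop α₁ α₂ P z = 1 := by
  rw [gLoop, formAdjoint_mul cxRho_mul_cxRho, formAdjoint_hLoop, formAdjoint_hLoop, sharp_sharp]
  calc _ = hLoop α₁ α₂ (sharp P) z * (hLoop α₂ α₁ P z * hLoop α₂ α₁ (sharp P) z)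
        * hLoop α₁ α₂ P z := by noncomm_ring
    _ = (hLoop α₁ α₂ (sharp P) z * hLoop α₂ α₁ (sharp P) z)
        * (hLoop α₂ α₁ P z * hLoop α₁ α₂ P z) := by
      rw [commute_hLoop hc]
      noncomm_ring
    _ = 1 := by
      rw [hLoop_mul_hLoop (sharp_mul_self hP) h₁ h₂, hLoop_mul_hLoop hP h₂ h₁, one_mul]

theorem tendsto_hLoop (α₁ α₂ : ℝ) (P : RMat n) :
    Filter.Tendsto (hLoop α₁ α₂ P) (Filter.cocompact ℂ) (𝓝 1) := by
  have h1 : Filter.Tendsto (fun z : ℂ => ((α₁ : ℂ) - α₂) / (z - α₁)) (Filter.cocompact ℂ) (𝓝 0) := by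
    have h2 : Filter.Tendsto (fun z : ℂ => z - α₁) (Filter.cocompact ℂ) (Filter.cocompact ℂ) :=
      (Homeomorph.subRight (α₁ : ℂ)).isClosedEmbedding.tendsto_cocompact
    rw [← Metric.cobounded_eq_cocompact] at h2 ⊢
    have h3 := (Filter.tendsto_inv₀_cobounded.comp h2).const_mul ((α₁ : ℂ) - α₂)
    rw [mul_zero] at h3
    exact h3
  have h4 := (h1.smul_const (cx (1 - P))).const_add 1
  rw [zero_smul, add_zero] at h4
  exact h4

theorem eq_of_tendsto_cocompact {G : ℂ → CMat n} {C : CMat n}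
    (hG : ∀ a b, Differentiable ℂ fun z => G z a b)
    (h : Filter.Tendsto G (Filter.cocompact ℂ) (𝓝 C)) (z : ℂ) : G z = C := by
  ext a b
  exact (hG a b).apply_eq_of_tendsto_cocompact z
    (((continuous_id.matrix_elem a b).tendsto C).comp h)

theorem eventually_ne_cocompact (α : ℂ) : ∀ᶠ z in Filter.cocompact ℂ, z ≠ α :=
  (Set.finite_singleton α).isCompact.compl_mem_cocompact

/-- If `G = g F M⁻¹` is entire with `g`, `F` orthogonal and `M` a product of two simple factors,
then `G` is orthogonal, and so is `M`. -/
theorem orthogonal_of_dressing {G F : ℂ → CMat n} {P Q S : RMat n} (hP : P * P = P)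
    (hc : P * sharp P = sharp P * P)
    (hF : ∀ z, (F z)ᵀ * cx (rho n) * F z = cx (rho n))
    (hG : ∀ a b, Differentiable ℂ fun z => G z a b)
    (h : ∀ z : ℂ, z ≠ α₁ → z ≠ α₂ →
      G z = gLoop α₁ α₂ P z * F z * hLoop α₂ α₁ Q z * hLoop α₁ α₂ S z) :
    (∀ z, (G z)ᵀ * cx (rho n) * G z = cx (rho n)) ∧
    ∀ z : ℂ, z ≠ α₁ → z ≠ α₂ → hLoop α₁ α₂ (sharp S) z * hLoop α₂ α₁ (sharp Q) z
      * (hLoop α₂ α₁ Q z * hLoop α₁ α₂ S z) = 1 := by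
  -- The orthogonal factors `g` and `F` drop out, leaving a product of four simple factors.
  have e : ∀ z : ℂ, z ≠ α₁ → z ≠ α₂ → formAdjoint (cx (rho n)) (G z) * G z
      = hLoop α₁ α₂ (sharp S) z * hLoop α₂ α₁ (sharp Q) z
        * (hLoop α₂ α₁ Q z * hLoop α₁ α₂ S z) := by
    intro z h₁ h₂
    have hF' := (formAdjoint_mul_self_eq_one cxRho_mul_cxRho).mpr (hF z)
    have hg := formAdjoint_gLoop_mul_gLoop hP hc h₁ h₂
    rw [h z h₁ h₂]
    simp only [formAdjoint_mul (cxRho_mul_cxRho (n := n)), formAdjoint_hLoop]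
    set H₁ := hLoop α₂ α₁ Q z
    set H₂ := hLoop α₁ α₂ S z
    set H₁' := hLoop α₂ α₁ (sharp Q) z
    set H₂' := hLoop α₁ α₂ (sharp S) z
    calc _ = H₂' * H₁' * (formAdjoint (cx (rho n)) (F z)
          * (formAdjoint (cx (rho n)) (gLoop α₁ α₂ P z) * gLoop α₁ α₂ P z) * F z)
          * (H₁ * H₂) := by noncomm_ring
      _ = _ := by rw [hg, mul_one, hF', mul_one]
  have hG' : ∀ z, formAdjoint (cx (rho n)) (G z) * G z = 1 := by
    -- Liouville: `G^♯ G` is entire and tends to `1` at infinity.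
    refine eq_of_tendsto_cocompact (fun a b => ?_) ?_
    · simp only [formAdjoint, Matrix.mul_apply, Matrix.transpose_apply]
      fun_prop
    · have h1 := ((tendsto_hLoop α₁ α₂ (sharp S)).mul (tendsto_hLoop α₂ α₁ (sharp Q))).mul
        ((tendsto_hLoop α₂ α₁ Q).mul (tendsto_hLoop α₁ α₂ S))
      simp only [one_mul] at h1
      refine h1.congr' ?_
      filter_upwards [eventually_ne_cocompact α₁, eventually_ne_cocompact α₂] with z h₁ h₂
      exact (e z h₁ h₂).symm
  exact ⟨fun z => (formAdjoint_mul_self_eq_one cxRho_mul_cxRho).mp (hG' z),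
    fun z h₁ h₂ => (e z h₁ h₂).symm.trans (hG' z)⟩

/-- A polynomial `w a + w² b` is determined by its values at `w = 1` and `w = 2`. -/
theorem quadratic_coeffs_eq {V : Type*} [AddCommGroup V] [Module ℂ V] {a b a' b' : V}
    (h1 : (1 : ℂ) • a + (1 : ℂ) • b = (1 : ℂ) • a' + (1 : ℂ) • b')
    (h2 : (2 : ℂ) • a + (4 : ℂ) • b = (2 : ℂ) • a' + (4 : ℂ) • b') : a = a' ∧ b = b' := by
  constructor
  · calc a = (2 : ℂ) • ((1 : ℂ) • a + (1 : ℂ) • b) - (1 / 2 : ℂ) • ((2 : ℂ) • a + (4 : ℂ) • b) := by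
          module
      _ = (2 : ℂ) • ((1 : ℂ) • a' + (1 : ℂ) • b')
          - (1 / 2 : ℂ) • ((2 : ℂ) • a' + (4 : ℂ) • b') := by rw [h1, h2]
      _ = a' := by module
  · calc b = (1 / 2 : ℂ) • ((2 : ℂ) • a + (4 : ℂ) • b) - ((1 : ℂ) • a + (1 : ℂ) • b) := by
          module
      _ = (1 / 2 : ℂ) • ((2 : ℂ) • a' + (4 : ℂ) • b') - ((1 : ℂ) • a' + (1 : ℂ) • b') := by
          rw [h1, h2]
      _ = b' := by module

theorem one_add_smul_mul_expand {R A : Type*} [CommRing R] [Ring A] [Algebra R A] (w : R)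
    (e f : A) : (1 + w • e) * (1 + w • f) = 1 + (w • (e + f) + (w * w) • (e * f)) := by
  simp only [mul_add, add_mul, one_mul, mul_one, smul_mul_assoc, mul_smul_comm, smul_add, mul_smul]
  abel

/-- The orthogonality of the rational loop `h_{α₂,α₁,S} h_{α₁,α₂,Q}` in terms of `Q` and `S`. -/
theorem proj_identities (hα : α₁ ≠ α₂) {Q S : RMat n} (hS : S * S = S)
    (h : ∀ z : ℂ, z ≠ α₁ → z ≠ α₂ → hLoop α₁ α₂ (sharp S) z * hLoop α₂ α₁ (sharp Q) z
      * (hLoop α₂ α₁ Q z * hLoop α₁ α₂ S z) = 1) :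
    (1 - sharp Q) + (1 - Q) = (1 - sharp S) + (1 - S) ∧
      (1 - sharp Q) * (1 - Q) = (1 - sharp S) * (1 - S) := by
  have key : ∀ z : ℂ, z ≠ α₁ → z ≠ α₂ →
      hLoop α₂ α₁ (sharp Q) z * hLoop α₂ α₁ Q z = hLoop α₂ α₁ (sharp S) z * hLoop α₂ α₁ S z := by
    intro z h₁ h₂
    have h1 := congrArg (fun X => hLoop α₂ α₁ (sharp S) z * X * hLoop α₂ α₁ S z) (h z h₁ h₂)
    simp only [mul_one] at h1
    rw [← h1]
    calc _ = (hLoop α₂ α₁ (sharp S) z * hLoop α₁ α₂ (sharp S) z)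
          * (hLoop α₂ α₁ (sharp Q) z * hLoop α₂ α₁ Q z)
          * (hLoop α₁ α₂ S z * hLoop α₂ α₁ S z) := by
          rw [hLoop_mul_hLoop (sharp_mul_self hS) h₂ h₁, hLoop_mul_hLoop hS h₁ h₂, one_mul, mul_one]
      _ = _ := by noncomm_ring
  have hd : (α₂ : ℂ) - α₁ ≠ 0 := sub_ne_zero.mpr (by exact_mod_cast hα.symm)
  -- Here `w = (α₂ - α₁)/(z - α₂)` is the scalar of the simple factor. The excluded values `0` and
  -- `-1` correspond to `z = ∞` and `z = α₁`.
  have key' : ∀ w : ℂ, w ≠ 0 → w ≠ -1 →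
      w • (cx (1 - sharp Q) + cx (1 - Q)) + (w * w) • (cx (1 - sharp Q) * cx (1 - Q))
      = w • (cx (1 - sharp S) + cx (1 - S)) + (w * w) • (cx (1 - sharp S) * cx (1 - S)) := by
    intro w hw hw'
    have h1 := key (α₂ + (α₂ - α₁) / w) ?_ ?_
    · have hz : ((α₂ : ℂ) - α₁) / ((α₂ : ℂ) + (α₂ - α₁) / w - α₂) = w := by
        rw [add_sub_cancel_left, div_div_cancel₀ hd]
      simp only [hLoop, hz, one_add_smul_mul_expand] at h1
      exact add_left_cancel h1
    · intro h'
      field_simp at h'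
      have h'' : ((α₂ : ℂ) - α₁) * (w + 1) = 0 := by linear_combination h'
      rcases mul_eq_zero.mp h'' with h0 | h0
      · exact hd h0
      · exact hw' (eq_neg_of_add_eq_zero_left h0)
    · intro h'
      have h'' : ((α₂ : ℂ) - α₁) / w = 0 := by linear_combination h'
      exact (div_ne_zero hd hw) h''
  have k1 := key' 1 one_ne_zero (by norm_num)
  have k2 := key' 2 two_ne_zero (by norm_num)
  rw [mul_one] at k1
  rw [show (2 : ℂ) * 2 = 4 by norm_num] at k2
  obtain ⟨e1, e2⟩ := quadratic_coeffs_eq k1 k2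
  rw [← cx_add, ← cx_add] at e1
  rw [← cx_mul, ← cx_mul] at e2
  exact ⟨cx_injective e1, cx_injective e2⟩

theorem conj_neg_eq {A : Type*} [Ring A] (a b t c d : A) :
    a * (b * (-t * c) * d) = -(a * b * t * (c * d)) := by noncomm_ring

/-- The identities between `Q` and `S` make the formal loop `M = h_{α₂,α₁,S} h_{α₁,α₂,Q}`
orthogonal, so conjugation by `M` preserves skewness. -/
theorem skew_dressSeries {Q S : RMat n} (hQ : Q * Q = Q) (hS : S * S = S)
    (h₁ : (1 - sharp Q) + (1 - Q) = (1 - sharp S) + (1 - S))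
    (h₂ : (1 - sharp Q) * (1 - Q) = (1 - sharp S) * (1 - S)) {T : LoopMat n}
    (hT : Tᵀ * constLoop (rho n) + constLoop (rho n) * T = 0) :
    (dressSeries α₂ α₁ S (dressSeries α₁ α₂ Q T))ᵀ * constLoop (rho n)
      + constLoop (rho n) * dressSeries α₂ α₁ S (dressSeries α₁ α₂ Q T) = 0 := by
  have hprod : hSeries α₂ α₁ (sharp Q) * hSeries α₂ α₁ Q
      = hSeries α₂ α₁ (sharp S) * hSeries α₂ α₁ S := by
    have e := fun X Y : RMat n =>
      one_add_smul_mul_expand (loopScalar α₂ α₁) (constLoop (1 - X)) (constLoop (1 - Y))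
    refine (e _ _).trans (Eq.trans ?_ (e _ _).symm)
    rw [← constLoop_add, ← constLoop_add, ← constLoop_mul, ← constLoop_mul, h₁, h₂]
  have hQ' := sharp_mul_self hQ
  have hS' := sharp_mul_self hS
  -- With this `M`, the identities `e1` and `e2` say `(M⁻¹)^♯ = M` and `M^♯ = M⁻¹`.
  have e1 : hSeries α₁ α₂ (sharp S) * hSeries α₂ α₁ (sharp Q)
      = hSeries α₂ α₁ S * hSeries α₁ α₂ Q := by
    calc _ = hSeries α₁ α₂ (sharp S) * (hSeries α₂ α₁ (sharp Q) * hSeries α₂ α₁ Q)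
          * hSeries α₁ α₂ Q := by
          rw [mul_assoc, mul_assoc, hSeries_mul_hSeries hQ, mul_one]
      _ = _ := by
          rw [hprod, ← mul_assoc, hSeries_mul_hSeries hS', one_mul]
  have e2 : hSeries α₁ α₂ (sharp Q) * hSeries α₂ α₁ (sharp S)
      = hSeries α₂ α₁ Q * hSeries α₁ α₂ S := by
    calc _ = hSeries α₁ α₂ (sharp Q) * (hSeries α₂ α₁ (sharp S) * hSeries α₂ α₁ S)
          * hSeries α₁ α₂ S := by
          rw [mul_assoc, mul_assoc, hSeries_mul_hSeries hS, mul_one]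
      _ = _ := by
          rw [← hprod, ← mul_assoc, hSeries_mul_hSeries hQ', one_mul]
  rw [skew_iff_formAdjoint constRho_mul_constRho] at hT ⊢
  simp only [dressSeries, formAdjoint_mul (constRho_mul_constRho (n := n)), formAdjoint_hSeries, hT]
  calc _ = -(hSeries α₁ α₂ (sharp S) * hSeries α₂ α₁ (sharp Q) * T
        * (hSeries α₁ α₂ (sharp Q) * hSeries α₂ α₁ (sharp S))) := by
          exact conj_neg_eq _ _ _ _ _
    _ = _ := by
      rw [e1, e2]
      noncomm_ring

end Orthogonality

end Orthogonal

/-! ### Identification of the limits that remove the singularities. -/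

section RemovableSingularities

variable {n : ℕ} {α₁ α₂ : ℝ} {Ω : Set (ℝ × ℝ)} {K K' : ℝ × ℝ → ℂ → CMat n} {P : RMat n}
  {Q : ℝ × ℝ → RMat n}

theorem IsDressing.congr {K'' : ℝ × ℝ → ℂ → CMat n} (h : IsDressing Ω K K' α₁ α₂ P Q)
    (e : ∀ p ∈ Ω, K'' p = K' p) : IsDressing Ω K K'' α₁ α₂ P Q where
  pullback := h.pullback
  smooth := h.smooth
  family := h.family.congr e
  eq p hp := by rw [e p hp]; exact h.eq p hp
  det p hp := by rw [e p hp]; exact h.det p hp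

/-- Removing the singularities of a function that agrees with the dressed loop off `α₁`, `α₂`. -/
theorem IsDressing.holoExt_eq (h : IsDressing Ω K K' α₁ α₂ P Q) {p : ℝ × ℝ} (hp : p ∈ Ω)
    {f : ℂ → CMat n} (hf : ∀ z : ℂ, z ≠ α₁ → z ≠ α₂ →
      f z = hLoop α₁ α₂ P z * K p z * hLoop α₂ α₁ (Q p) z) : holoExt f = K' p := by
  rw [holoExt_congr (g := K' p) (a := α₁) (b := α₂) fun z h₁ h₂ =>
    (hf z h₁ h₂).trans (h.eq p hp z h₁ h₂).symm]
  exact holoExt_of_continuous (h.family.continuous hp)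

end RemovableSingularities

end BnDarboux
end

open BnDarboux
theorem mainTheorem6 (n j : ℕ) (hn : 1 ≤ n) (hj : 1 ≤ j)
    (q : ℝ × ℝ → RMat n) (F : ℝ × ℝ → ℂ → CMat n)
    (hq : IsSolutionOn n j Set.univ q) (hF : IsFrameOn n j Set.univ q F)
    (α₁ α₂ : ℝ) (hα : α₁ ≠ α₂)
    (P : RMat n) (hP : P * P = P) (hP₁ : P * sharp P = 0) (hP₂ : sharp P * P = 0)
    (U U₁ : Set (ℝ × ℝ)) (hU : IsOpen U) (hU₁ : IsOpen U₁) (hUU : U₁ ⊆ U)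
    (hV : ∀ p ∈ U, tildeV₁ F α₁ P p ⊓ tildeV₂ F α₂ P p = ⊥)
    (hW : ∀ p ∈ U₁, W₁ F α₁ α₂ P p ⊓ W₂ F α₁ α₂ P p = ⊥) :
    -- the objects of the construction are well defined
    (∀ p ∈ U, IsCompl (tildeV₁ F α₁ P p) (tildeV₂ F α₂ P p)) ∧
    (∀ p ∈ U, ∀ z : ℂ, z ≠ (α₁ : ℂ) → z ≠ (α₂ : ℂ) →
      kLoop F α₁ α₂ P p z = kRaw F α₁ α₂ P p z) ∧
    (∀ p ∈ U, ∀ a b : Fin (2 * n + 1), Differentiable ℂ (fun z => kLoop F α₁ α₂ P p z a b)) ∧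
    (∀ p ∈ U, ∀ z : ℂ, IsUnit (kLoop F α₁ α₂ P p z).det) ∧
    (∀ p ∈ U₁, IsCompl (W₂ F α₁ α₂ P p) (W₁ F α₁ α₂ P p)) ∧
    (∀ p ∈ U₁, ∀ z : ℂ, z ≠ (α₁ : ℂ) → z ≠ (α₂ : ℂ) →
      tildeF F α₁ α₂ P p z = tildeFRaw F α₁ α₂ P p z) ∧
    -- the new solution and its frame
    IsSolutionOn n j U₁ (tildeQ F α₁ α₂ P q) ∧
    IsFrameOn n j U₁ (tildeQ F α₁ α₂ P q) (tildeF F α₁ α₂ P) := by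
  obtain ⟨T, hT, hL⟩ := hF.exists_isLaxFrameOn isOpen_univ
  have hLU : IsLaxFrameOn n j U q T F := hL.mono (Set.subset_univ U)
  -- dressing by `π̃`
  obtain ⟨hVc, hD0⟩ := isDressing_dressedLoop hU hLU.family hP hV
  have hkRaw : ∀ p ∈ U, ∀ z : ℂ, z ≠ α₁ → z ≠ α₂ → kRaw F α₁ α₂ P p z
      = hLoop α₁ α₂ P z * F p z * hLoop α₂ α₁ (tildeP F α₁ α₂ P p) z := by
    intro p hp z h₁ h₂
    have hi : tildeP F α₁ α₂ P p * tildeP F α₁ α₂ P p = tildeP F α₁ α₂ P p :=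
      (hD0.pullback p hp).idem
    rw [kRaw, hLoop_inv hi h₁ h₂]
  -- The extension defined by limits coincides with the one built from divided differences.
  have hD : IsDressing U F (kLoop F α₁ α₂ P) α₁ α₂ P (tildeP F α₁ α₂ P) :=
    hD0.congr fun p hp => hD0.holoExt_eq hp (hkRaw p hp)
  have hL1 := (hLU.dress hU hj hD).mono hUU
  -- dressing by `θ`
  have hP' := sharp_mul_self hP
  -- The image of `P^♯` belongs to `α₂` and its kernel to `α₁`, so this is the first step with the
  -- parameters exchanged.
  have hW' : ∀ p ∈ U₁, invImage (kLoop F α₁ α₂ P p α₂) (im (sharp P))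
      ⊓ invImage (kLoop F α₁ α₂ P p α₁) (ker (sharp P)) = ⊥ := by
    intro p hp
    rw [← perp_ker hP, ← perp_im, inf_comm]
    exact hW p hp
  obtain ⟨hWc, hE0⟩ := isDressing_dressedLoop hU₁ hL1.family hP' hW'
  have htheta : (fun p => projAlong (invImage (kLoop F α₁ α₂ P p α₂) (im (sharp P)))
      (invImage (kLoop F α₁ α₂ P p α₁) (ker (sharp P)))) = theta F α₁ α₂ P := by
    funext p
    rw [← perp_ker hP, ← perp_im]
    rfl
  simp only [congrFun htheta] at hE0
  have hRaw : ∀ p ∈ U₁, ∀ z : ℂ, z ≠ α₁ → z ≠ α₂ → tildeFRaw F α₁ α₂ P p z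
      = hLoop α₂ α₁ (sharp P) z * kLoop F α₁ α₂ P p z * hLoop α₁ α₂ (theta F α₁ α₂ P p) z := by
    intro p hp z h₁ h₂
    rw [hD.eq p (hUU hp) z h₁ h₂, tildeFRaw, gLoop, hLoop_inv (hD.pullback p (hUU hp)).idem h₁ h₂,
      hLoop_inv (hE0.pullback p hp).idem h₂ h₁]
    simp only [mul_assoc]
  have hE : IsDressing U₁ (kLoop F α₁ α₂ P) (tildeF F α₁ α₂ P) α₂ α₁ (sharp P)
      (theta F α₁ α₂ P) :=
    hE0.congr fun p hp => hE0.holoExt_eq hp fun z h₂ h₁ => hRaw p hp z h₁ h₂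
  have hL2 := hL1.dress hU₁ hj hE
  have hQ : (fun p => q p + (α₁ - α₂) • ⁅beta n, tildeP F α₁ α₂ P p⁆
      + (α₂ - α₁) • ⁅beta n, theta F α₁ α₂ P p⁆) = tildeQ F α₁ α₂ P q := by
    funext p
    simp only [tildeQ, Ring.lie_def, mul_sub, sub_mul, smul_sub, sub_smul]
    abel
  rw [hQ] at hL2
  -- orthogonality
  have horth := fun p (hp : p ∈ U₁) =>
    orthogonal_of_dressing (α₁ := α₁) (α₂ := α₂) (G := tildeF F α₁ α₂ P p) (F := F p)
      (Q := tildeP F α₁ α₂ P p) (S := theta F α₁ α₂ P p) hP (hP₁.trans hP₂.symm)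
      (fun z => (hF.mem p trivial z).2) (hE.family.holo p hp) (fun z h₁ h₂ => by
        rw [hE.eq p hp z h₂ h₁, hD.eq p (hUU hp) z h₁ h₂, gLoop]
        simp only [mul_assoc])
  have hmem : ∀ p ∈ U₁, ∀ z, MemOC (tildeF F α₁ α₂ P p z) := fun p hp z =>
    ⟨by rw [hE.det p hp, hD.det p (hUU hp), (hF.mem p trivial z).1], (horth p hp).1 z⟩
  -- The left side of the second identity from `orthogonal_of_dressing` does not involve `F`, so it
  -- transfers to formal series.
  have hT2 : IsT n U₁ (tildeQ F α₁ α₂ P q) _ := hL2.isT fun p hp => by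
    have hid := proj_identities hα (hE.pullback p hp).idem (horth p hp).2
    exact skew_dressSeries (hD.pullback p (hUU hp)).idem (hE.pullback p hp).idem hid.1 hid.2
      (hT.skew p trivial)
  have hqs : SmoothMatOn U₁ (tildeQ F α₁ α₂ P q) := by
    have hX : SmoothMatOn U₁ fun p => tildeP F α₁ α₂ P p - theta F α₁ α₂ P p :=
      (hD.smooth.mono hUU).sub hE.smooth
    have hq' : SmoothMatOn U₁ q := SmoothMatOn.mono hq.smooth (Set.subset_univ _)
    exact (hq'.add ((((SmoothMatOn.const (beta n)).mul hX).sub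
      (hX.mul (.const (beta n)))).const_smul (α₁ - α₂)))
  -- Both `b + q̃` and `b + q` are skew, as logarithmic derivatives of orthogonal frames at `λ = 0`;
  -- the constant `b` cancels.
  have hskew : ∀ p ∈ U₁, (tildeQ F α₁ α₂ P q p - q p)ᵀ * rho n
      + rho n * (tildeQ F α₁ α₂ P q p - q p) = 0 := by
    intro p hp
    have h1 := hL2.skew_potential hU₁ hmem hp
    have h2 := hL.skew_potential isOpen_univ hF.mem (p := p) trivial
    rw [← sub_eq_zero.mpr (h1.trans h2.symm)]
    simp only [Matrix.transpose_sub, Matrix.transpose_add]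
    noncomm_ring
  refine ⟨hVc, fun p hp z h₁ h₂ => (hD.eq p hp z h₁ h₂).trans (hkRaw p hp z h₁ h₂).symm,
    hD.family.holo, hD.family.det, fun p hp => ?_,
    fun p hp z h₁ h₂ => (hE.eq p hp z h₂ h₁).trans (hRaw p hp z h₁ h₂).symm,
    ⟨hqs, fun p hp => ⟨?_, fun a b hab => ?_⟩, _, hT2, fun p hp => hL2.flow hU₁ hj hqs hp⟩,
    hL2.isFrameOn hT2 hmem⟩
  · have := hWc p hp
    rwa [← perp_ker hP, ← perp_im] at this
  · have h1 := hskew p hp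
    have h2 := (hq.mem p trivial).1
    rw [← add_zero (0 : RMat n)]
    nth_rw 1 [← h1]
    rw [← h2, Matrix.transpose_sub]
    noncomm_ring
  · have h1 := hskew p hp
    have e : tildeQ F α₁ α₂ P q p - q p
        = (α₁ - α₂) • ⁅beta n, tildeP F α₁ α₂ P p - theta F α₁ α₂ P p⁆ := by
      rw [tildeQ, add_sub_cancel_left]
    rw [e] at h1
    have h2 := upperTriangular_of_skew hn h1 hab
    rw [← e, Matrix.sub_apply, (hq.mem p trivial).2 a b hab, sub_zero] at h2
    exact h2
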